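/- **Setting.** A non-square polynomial $D\in\mathbb C[t]$ of even positive degree is *Pellian* if $x^2-Dy^2=1$ has a solution in non-zero polynomials $x,y\in\mathbb C[t]$. The continued fraction expansion of $f\in\mathbb C((t^{-1}))$ has complete quotients $\alpha_0=f$, $\alpha_{n+1}=(\alpha_n-a_n)^{-1}$ and partial quotients $a_n=\lfloor\alpha_n\rfloor$ (polynomial part), $n\ge 0$. Below, $\sqrt D$ is any square root of $D$ in $\mathbb C((t^{-1}))$ (square roots exist for all the $D$ considered). Let $b_1,\dots,b_g\in\mathbb C^*$ be such that $b_1^{\pm1},\dots,b_g^{\pm1}$ are $2g$ distinct numbers; put $\rho_i=\frac12(b_i+b_i^{-1})$ and $D(t)=(t^2-1)\prod_{i=1}^g(t-\rho_i)^2$, of degree $2d$ with $d=g+1$. Let $\mathcal C$ be the projective closure of the conic $u^2=t^2-1$, with points at infinity $\infty_\pm=(\pm1:1:0)$ (in coordinates $(T:U:V)$, $t=T/V$, $u=U/V$), identified with $\mathbb P^1(\mathbb C)$ by $s=t+u$ (so $\infty_+$, $\infty_-$ are $s=\infty$, $s=0$). Let $S\subset\mathcal C$ be the set of the points with $s\in\{b_1^{\pm1},\dots,b_g^{\pm1}\}$,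 $\mathfrak m=\sum_{P\in S}P$, and let $J_{\mathfrak m}$ be the generalized Jacobian, i.e. the group of divisors of degree $0$ with support disjoint from $S$, modulo the divisors of functions equal to $1$ on $S$. Let $G$ be the quotient of $J_{\mathfrak m}$ by the classes of divisors of functions in $\mathbb C(t)^*$ (so that $\operatorname{div} f\mapsto (f(b_i)/f(b_i^{-1}))_i$ identifies $G$ with $(\mathbb C^*)^g$). Write $[P]\in G$ for the class of $(P)-(\infty_+)$, $\delta=[\infty_-]$, and $W_l=\{[P_1]+\dots+[P_l]: P_j\in\mathcal C\setminus S\}$; $\delta^n$ denotes the $n$-fold multiple of $\delta$ in $G$. **Claims.** 1. Let $l,p,q$ be positive integers with $p\le l-1$, $q\le l$, $g:=p+q$ and $\frac d2\le l\le g$, where $d=g+1$. Let $\omega$ be a primitive $2l$-th root of unity, let $h\in\mathbb C^*$ not be a root of unity, and put $b_i=\omega^i$ for $1\le i\le p$ and $b_i=h\,\omega^{2i}$ for $p+1\le i\le p+q$. Then the $b_i^{\pm1}$ are $2g$ distinct numbers, $D$ is not Pellian, $\delta^n\in W_l$ for infinitely many $n$, the sequence of partial quotients of $\sqrt D$ is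 not eventually periodic, and infinitely many partial quotients have degree $\ge d-l$; in particular, if $l<g$, infinitely many partial quotients have degree $>1$. 2. Let $g=4$ and $(b_1,b_2,b_3,b_4)=(\theta_1,h,\theta_2h,\theta_3h)$, where $\theta_1,\theta_2,\theta_3$ are roots of unity of odd orders $N_1,N_2,N_3$, $h\in\mathbb C^*$ is not a root of unity, the $b_i^{\pm1}$ are $8$ distinct numbers, and $$h^3(1+\theta_1+\theta_1^2)\theta_2\theta_3-h^2(\theta_2+\theta_3+\theta_2\theta_3)\theta_1-h(1+\theta_2+\theta_3)\theta_1+(1+\theta_1+\theta_1^2)=0 .$$ Then $D$ is not Pellian, $\delta^n\in W_3$ for infinitely many $n$ such that $2n-3$ is divisible by $N_1,N_2,N_3$, the sequence of partial quotients of $\sqrt D$ is not eventually periodic, and infinitely many partial quotients have degree $2$. Such parameters exist with $N_1$ arbitrarily large. 3. Let $$D(t)=\tfrac1{4096}(t^2-1)(4t^2-1)^2(16t^2+20t+13)^2 .$$ For every primitive sixth root of unity $\zeta$, the eight numbers $b_i^{\pm1}$ with $(b_1,b_2,b_3,b_4)=(\zeta,\zeta^2,2\zeta^2,2\zeta^4)$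 are distinct, $D$ is the polynomial attached to these $b_i$, and $\delta^{3n}\in W_3$ for all $n\ge0$. The polynomial $D$ is not Pellian, the sequence of partial quotients of $\sqrt D$ is not eventually periodic, and the degrees of the partial quotients of $\sqrt D$ are $5,1,2,1,2,1,2,\dots$, i.e. $5,\overline{1,2}$. -/

import Mathlib

open Polynomial

noncomputable section

namespace PolyPell

/-! ### Pell equation and continued fractions in `ℂ((t⁻¹))` -/

/-- `D` is Pellian: `x² - D y² = 1` has a solution in non-zero polynomials `x`, `y`. -/
def IsPellian (D : ℂ[X]) : Prop :=
  ∃ x y : ℂ[X], x ≠ 0 ∧ y ≠ 0 ∧ x ^ 2 - D * y ^ 2 = 1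

/-- The embedding `ℂ[t] → ℂ((t⁻¹))`. An element of `LaurentSeries ℂ` is read as a series in the
variable `t⁻¹`, so that `t` is the series with the single coefficient `1` at the exponent `-1`. -/
def seriesOf : ℂ[X] →ₐ[ℂ] LaurentSeries ℂ :=
  Polynomial.aeval (HahnSeries.single (-1 : ℤ) (1 : ℂ))

/-- The polynomial part of a series in `t⁻¹`: the coefficient of `t ^ k` in `polyPart f`, `k ≥ 0`,
is the coefficient of `(t⁻¹) ^ (-k)` in `f`. -/
def polyPart (f : LaurentSeries ℂ) : ℂ[X] :=
  ∑ k ∈ Finset.range ((-f.order).toNat + 1), monomial k (f.coeff (-(k : ℤ)))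

/-- The complete quotients `α₀ = f`, `αₙ₊₁ = (αₙ - ⌊αₙ⌋)⁻¹`. (If `f` is a rational function, then
`αₙ = ⌊αₙ⌋` for some `n`, and all later complete quotients are `0`.) -/
def completeQuotient (f : LaurentSeries ℂ) : ℕ → LaurentSeries ℂ
  | 0 => f
  | n + 1 => (completeQuotient f n - seriesOf (polyPart (completeQuotient f n)))⁻¹

/-- The partial quotients `aₙ = ⌊αₙ⌋` of the continued fraction expansion of `f`. -/
def partialQuotient (f : LaurentSeries ℂ) (n : ℕ) : ℂ[X] :=
  polyPart (completeQuotient f n)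

/-- Eventual periodicity of a sequence. -/
def IsEventuallyPeriodic {α : Type*} (a : ℕ → α) : Prop :=
  ∃ N m : ℕ, 0 < m ∧ ∀ n, N ≤ n → a (n + m) = a n

/-! ### The polynomial `D` attached to `b₁, …, b_g` -/

/-- `b₁^{±1}, …, b_g^{±1}` are `2g` distinct numbers (equivalently, the `ρᵢ = (bᵢ + bᵢ⁻¹) / 2` are
distinct and none of them is `±1`). -/
def IsAdmissible {g : ℕ} (b : Fin g → ℂˣ) : Prop :=
  Function.Injective b ∧ ∀ i j, b i ≠ (b j)⁻¹

/-- `ρᵢ = (bᵢ + bᵢ⁻¹) / 2`, so that `bᵢ = ρᵢ + √(ρᵢ² - 1)` for one of the two square roots. -/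
def rho {g : ℕ} (b : Fin g → ℂˣ) (i : Fin g) : ℂ :=
  ((b i : ℂ) + ((b i)⁻¹ : ℂˣ)) / 2

/-- `D(t) = (t² - 1) (t - ρ₁)² ⋯ (t - ρ_g)²`. -/
def polyD {g : ℕ} (b : Fin g → ℂˣ) : ℂ[X] :=
  (X ^ 2 - 1) * (∏ i, (X - C (rho b i))) ^ 2

/-! ### The group `G`, the point `δ` and the sets `W_l`

The conic `u² = t² - 1` is identified with the projective line `ℂ ∪ {∞}` by the coordinate
`s = t + u`, the inverse map being `s ↦ ((s + s⁻¹) / 2, (s - s⁻¹) / 2)`. The point at infinity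
`∞₊ = (1 : 1 : 0)` has `s = ∞`, the point at infinity `∞₋ = (-1 : 1 : 0)` has `s = 0`, the points
`(ρᵢ, ±√(ρᵢ² - 1))` have `s = bᵢ^{±1}`, and the nontrivial automorphism `(t, u) ↦ (t, -u)` over
`ℂ(t)` is `s ↦ s⁻¹`. The function field of the conic is `ℂ(s)`. -/

/-- The order of a rational function at a point of the projective line. -/
def ordAt (f : RatFunc ℂ) : OnePoint ℂ → ℤ
  | none => -f.intDegree
  | some a => (f.num.rootMultiplicity a : ℤ) - (f.denom.rootMultiplicity a : ℤ)

/-- `E` is the divisor of the nonzero rational function `f`. -/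
def IsDivisorOf (E : OnePoint ℂ →₀ ℤ) (f : RatFunc ℂ) : Prop :=
  f ≠ 0 ∧ ∀ P, E P = ordAt f P

/-- `f` has neither zero nor pole among the `bᵢ^{±1}` and takes the value `1` at each of them.
(`RatFunc.eval` is `0` at a pole.) -/
def IsOneOnSupport {g : ℕ} (b : Fin g → ℂˣ) (f : RatFunc ℂ) : Prop :=
  ∀ i, f.eval (RingHom.id ℂ) (b i : ℂ) = 1 ∧ f.eval (RingHom.id ℂ) ((b i)⁻¹ : ℂˣ) = 1

/-- `f` is invariant under `s ↦ s⁻¹`, that is, `f` belongs to `ℂ(t)`. -/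
def IsGaloisInvariant (f : RatFunc ℂ) : Prop :=
  f.eval RatFunc.C (RatFunc.X)⁻¹ = f

/-- The support `{b₁^{±1}, …, b_g^{±1}}` of the modulus `𝔪`. -/
def modulusSupport {g : ℕ} (b : Fin g → ℂˣ) : Set (OnePoint ℂ) :=
  {P | ∃ i, P = ((b i : ℂ) : OnePoint ℂ) ∨ P = ((((b i)⁻¹ : ℂˣ) : ℂ) : OnePoint ℂ)}

/-- The divisors of degree zero whose support is disjoint from `𝔪`. -/
def divZero {g : ℕ} (b : Fin g → ℂˣ) : AddSubgroup (OnePoint ℂ →₀ ℤ) where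
  carrier := {E | (E.sum fun _ n => n) = 0 ∧ ∀ P ∈ modulusSupport b, E P = 0}
  zero_mem' := by simp
  add_mem' := by
    rintro E F ⟨hE, hE'⟩ ⟨hF, hF'⟩
    refine ⟨?_, fun P hP => by simp [hE' P hP, hF' P hP]⟩
    rw [Finsupp.sum_add_index' (fun _ => rfl) (fun _ _ _ => rfl), hE, hF, add_zero]
  neg_mem' := by
    rintro E ⟨hE, hE'⟩
    refine ⟨?_, fun P hP => by simp [hE' P hP]⟩
    rw [Finsupp.sum_neg_index (fun _ => rfl)]
    simpa [Finsupp.sum] using hE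

/-- The divisors that are `𝔪`-equivalent to `0`. -/
def mTrivial {g : ℕ} (b : Fin g → ℂˣ) : AddSubgroup (divZero b) :=
  AddSubgroup.closure
    {E | ∃ f : RatFunc ℂ, IsDivisorOf (E : OnePoint ℂ →₀ ℤ) f ∧ IsOneOnSupport b f}

/-- The generalized Jacobian `J_𝔪`. -/
abbrev GenJacobian {g : ℕ} (b : Fin g → ℂˣ) : Type :=
  divZero b ⧸ mTrivial b

/-- The subgroup of `J_𝔪` of the classes of divisors of Galois-invariant functions. -/
def invariantPart {g : ℕ} (b : Fin g → ℂˣ) : AddSubgroup (GenJacobian b) :=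
  AddSubgroup.closure
    {x | ∃ (E : divZero b) (f : RatFunc ℂ), IsDivisorOf (E : OnePoint ℂ →₀ ℤ) f ∧
      IsGaloisInvariant f ∧ x = QuotientAddGroup.mk E}

/-- The group `G`, written additively. Evaluating `f(bᵢ) / f(bᵢ⁻¹)` at the functions `f` with
divisor `E` identifies it with `(ℂˣ)^g`. -/
abbrev GroupG {g : ℕ} (b : Fin g → ℂˣ) : Type :=
  GenJacobian b ⧸ invariantPart b

lemma infty_not_mem_modulusSupport {g : ℕ} (b : Fin g → ℂˣ) : OnePoint.infty ∉ modulusSupport b := by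
  rintro ⟨i, h | h⟩
  · exact OnePoint.infty_ne_coe _ h
  · exact OnePoint.infty_ne_coe _ h

lemma zero_not_mem_modulusSupport {g : ℕ} (b : Fin g → ℂˣ) :
    ((0 : ℂ) : OnePoint ℂ) ∉ modulusSupport b := by
  rintro ⟨i, h | h⟩
  · exact (b i).ne_zero (OnePoint.coe_eq_coe.mp h).symm
  · exact ((b i)⁻¹).ne_zero (OnePoint.coe_eq_coe.mp h).symm

/-- The divisor `(P) - (∞₊)`, for a point `P` outside the support of `𝔪`. -/
def pointDivisor {g : ℕ} (b : Fin g → ℂˣ) (P : {P : OnePoint ℂ // P ∉ modulusSupport b}) : divZero b :=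
  ⟨Finsupp.single P.1 1 - Finsupp.single OnePoint.infty 1, by
    refine ⟨?_, fun Q hQ => ?_⟩
    · rw [Finsupp.sum_sub_index (fun _ _ _ => rfl)]
      simp
    · have h1 : P.1 ≠ Q := fun h => P.2 (h ▸ hQ)
      have h2 : OnePoint.infty ≠ Q := fun h => infty_not_mem_modulusSupport b (h ▸ hQ)
      simp [h1, h2]⟩

/-- The class `[P]` of `(P) - (∞₊)` in `G`. -/
def pointClass {g : ℕ} (b : Fin g → ℂˣ) (P : {P : OnePoint ℂ // P ∉ modulusSupport b}) : GroupG b :=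
  QuotientAddGroup.mk (QuotientAddGroup.mk (pointDivisor b P))

/-- The class `δ` of `(∞₋) - (∞₊)` in `G`. -/
def delta {g : ℕ} (b : Fin g → ℂˣ) : GroupG b :=
  pointClass b ⟨((0 : ℂ) : OnePoint ℂ), zero_not_mem_modulusSupport b⟩

/-- `W_l = {[P₁] + ⋯ + [P_l]}`, the `Pⱼ` being points of the conic outside the support of `𝔪`. -/
def setW {g : ℕ} (b : Fin g → ℂˣ) (l : ℕ) : Set (GroupG b) :=
  Set.range fun P : Fin l → {P : OnePoint ℂ // P ∉ modulusSupport b} => ∑ j, pointClass b (P j)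

/-! ### The examples -/

/-- `bᵢ = ω ^ i` for `1 ≤ i ≤ p` and `bᵢ = h ω ^ (2 i)` for `p + 1 ≤ i ≤ p + q`; the index `i` is
`k + 1` for `k : Fin (p + q)`. -/
def familyOne (p q : ℕ) (ω h : ℂˣ) (k : Fin (p + q)) : ℂˣ :=
  if (k : ℕ) + 1 ≤ p then ω ^ ((k : ℕ) + 1) else h * ω ^ (2 * ((k : ℕ) + 1))

/-- `b = (θ₁, h, θ₂ h, θ₃ h)`. -/
def familyTwo (θ₁ θ₂ θ₃ h : ℂˣ) : Fin 4 → ℂˣ :=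
  ![θ₁, h, θ₂ * h, θ₃ * h]

/-- The conditions on the parameters of the second family. -/
structure IsFamilyTwoParam (θ₁ θ₂ θ₃ h : ℂˣ) : Prop where
  odd₁ : Odd (orderOf θ₁)
  odd₂ : Odd (orderOf θ₂)
  odd₃ : Odd (orderOf θ₃)
  not_root_of_unity : ¬ IsOfFinOrder h
  admissible : IsAdmissible (familyTwo θ₁ θ₂ θ₃ h)
  equation : (h : ℂ) ^ 3 * (1 + θ₁ + θ₁ ^ 2) * θ₂ * θ₃ - (h : ℂ) ^ 2 * (θ₂ + θ₃ + θ₂ * θ₃) * θ₁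
    - (h : ℂ) * (1 + θ₂ + θ₃) * θ₁ + (1 + θ₁ + θ₁ ^ 2) = 0

/-- `(1 / 4096) (t² - 1) (4 t² - 1)² (16 t² + 20 t + 13)²`. -/
def exampleD : ℂ[X] :=
  C (1 / 4096) * (X ^ 2 - 1) * (4 * X ^ 2 - 1) ^ 2 * (16 * X ^ 2 + 20 * X + 13) ^ 2

/-- `b = (ζ, ζ², 2 ζ², 2 ζ⁴)`. -/
def exampleB (ζ : ℂˣ) : Fin 4 → ℂˣ :=
  ![ζ, ζ ^ 2, Units.mk0 (2 : ℂ) two_ne_zero * ζ ^ 2, Units.mk0 (2 : ℂ) two_ne_zero * ζ ^ 4]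

end PolyPell

end

open Polynomial

noncomputable section

namespace PolyPell

/-! ### Orders of series in `t⁻¹` -/

/-! Put t = (s + s⁻¹)/2, u = (s - s⁻¹)/2 and R = ∏ (t - ρᵢ), so that √D = ±uR. The central object is
a witness (`IsWitness`): a polynomial A of degree l with A(0) ≠ 0, such that s⁻ⁿA(s) takes the same
value at bᵢ and bᵢ⁻¹, and A(s), A(s⁻¹) have no common zero. It is used twice.

In G: s⁻ⁿA(s) agrees on S with a polynomial in t, so its divisor has trivial class. That divisor
compares the zeros of A with n times ∞₋, whence nδ ∈ W_l (`nsmul_delta_mem_setW`).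

In the continued fraction: the part of s⁻ⁿA(s) odd under s ↦ s⁻¹ is u times a polynomial in t
vanishing at every ρᵢ, hence divisible by R. So s⁻ⁿA(s) = p - q√D up to the sign of q, with p, q
polynomials in t. If s has a simple pole, the right side has order n - l in t⁻¹, while deg q = n - g
- 1. For l ≤ g this makes p/q a convergent followed by a partial quotient of degree g + 1 - l
(`exists_denDeg_of_witness`, through `exists_denDeg_of_approx`).

A Pell solution makes x + uRy a unit on the affine conic, hence a constant times a power of s. Its
values at bᵢ and bᵢ⁻¹ agree, so if bᵢ is not a root of unity it is constant, forcing y = 0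
(`not_isPellian_of_not_isOfFinOrder`). Eventual periodicity would yield a Pell solution
(`isPellian_of_isEventuallyPeriodic`), so it fails too.

What remains is to write down witnesses for arbitrarily large n: a binomial in s^l for the first
family, a combination of a cubic and its reciprocal for the second. The explicit D is a member of
the first family, and there the witnesses determine all denominator degrees (`denDeg_example`). -/

lemma algebraMap_laurentSeries (c : ℂ) :
    (algebraMap ℂ (LaurentSeries ℂ)) c = HahnSeries.C c := by
  rw [HahnSeries.algebraMap_apply']
  exact HahnSeries.ofPowerSeries_C c

lemma seriesOf_eq_sum (p : ℂ[X]) :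
    seriesOf p = ∑ i ∈ Finset.range (p.natDegree + 1), HahnSeries.single (-(i : ℤ)) (p.coeff i) := by
  rw [seriesOf, Polynomial.aeval_eq_sum_range]
  refine Finset.sum_congr rfl fun i _ => ?_
  rw [HahnSeries.single_pow, one_pow]
  rw [Algebra.smul_def, algebraMap_laurentSeries, HahnSeries.C_apply,
    HahnSeries.single_mul_single]
  simp

lemma coeff_seriesOf_neg (p : ℂ[X]) (k : ℕ) : (seriesOf p).coeff (-(k : ℤ)) = p.coeff k := by
  rw [seriesOf_eq_sum, HahnSeries.coeff_sum]
  simp only [HahnSeries.coeff_single, neg_inj, Nat.cast_inj]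
  rw [Finset.sum_ite_eq]
  split_ifs with h
  · rfl
  · rw [Finset.mem_range, not_lt] at h
    exact (coeff_eq_zero_of_natDegree_lt h).symm

lemma seriesOf_injective : Function.Injective seriesOf := fun p q h => by
  ext k
  rw [← coeff_seriesOf_neg, h, coeff_seriesOf_neg]

lemma seriesOf_ne_zero {p : ℂ[X]} (hp : p ≠ 0) : seriesOf p ≠ 0 := by
  rw [← map_zero seriesOf]
  exact seriesOf_injective.ne hp

lemma order_seriesOf (p : ℂ[X]) : (seriesOf p).order = -(p.natDegree : ℤ) := by
  by_cases hp : p = 0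
  · simp [hp]
  refine le_antisymm (HahnSeries.order_le_of_coeff_ne_zero ?_) ?_
  · rw [coeff_seriesOf_neg]
    exact leadingCoeff_ne_zero.mpr hp
  · rw [HahnSeries.le_order_iff_forall (seriesOf_ne_zero hp)]
    intro j hj
    obtain ⟨k, rfl⟩ : ∃ k : ℕ, j = -(k : ℤ) := ⟨(-j).toNat, by omega⟩
    rw [coeff_seriesOf_neg]
    exact coeff_eq_zero_of_natDegree_lt (by omega)

/-- This turns order estimates into polynomial identities. `orderTop` is used because `order`
assigns the value 0 to the zero series. -/
lemma eq_zero_of_orderTop_seriesOf_pos {p : ℂ[X]} (h : 0 < (seriesOf p).orderTop) : p = 0 := by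
  by_contra hp
  have := (HahnSeries.zero_lt_orderTop_iff (seriesOf_ne_zero hp)).mp h
  rw [order_seriesOf] at this
  omega

lemma coeff_polyPart (f : LaurentSeries ℂ) (k : ℕ) : (polyPart f).coeff k = f.coeff (-(k : ℤ)) := by
  rw [polyPart, finsetSum_coeff]
  simp only [coeff_monomial]
  rw [Finset.sum_ite_eq']
  split_ifs with h
  · rfl
  · rw [Finset.mem_range, not_lt] at h
    exact (HahnSeries.coeff_eq_zero_of_lt_order (by omega)).symm

lemma orderTop_sub_polyPart_pos (f : LaurentSeries ℂ) :
    0 < (f - seriesOf (polyPart f)).orderTop := by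
  by_cases h0 : f - seriesOf (polyPart f) = 0
  · rw [h0, HahnSeries.orderTop_zero]; exact WithTop.coe_lt_top 0
  rw [HahnSeries.zero_lt_orderTop_iff h0, Int.lt_iff_add_one_le, HahnSeries.le_order_iff_forall h0]
  intro j hj
  obtain ⟨k, rfl⟩ : ∃ k : ℕ, j = -(k : ℤ) := ⟨(-j).toNat, by omega⟩
  rw [HahnSeries.coeff_sub, coeff_seriesOf_neg, coeff_polyPart, sub_self]

lemma natDegree_polyPart {f : LaurentSeries ℂ} (hf : f.order ≤ 0) :
    ((polyPart f).natDegree : ℤ) = -f.order := by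
  by_cases h0 : f = 0
  · subst h0
    have : polyPart 0 = 0 := by ext k; simp [coeff_polyPart]
    simp [this]
  have hk : f.order = -((-f.order).toNat : ℤ) := by omega
  have h1 : (polyPart f).natDegree = (-f.order).toNat := by
    refine natDegree_eq_of_le_of_coeff_ne_zero ?_ ?_
    · rw [natDegree_le_iff_coeff_eq_zero]
      intro N hN
      rw [coeff_polyPart]
      exact HahnSeries.coeff_eq_zero_of_lt_order (by omega)
    · rw [coeff_polyPart, ← hk]
      exact mt HahnSeries.coeff_order_eq_zero.mp h0
  omega

/-! ### Continued fractions of irrational series -/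

/-- `f` is not a rational function. -/
def IsIrrational (f : LaurentSeries ℂ) : Prop :=
  ∀ p q : ℂ[X], q ≠ 0 → seriesOf q * f ≠ seriesOf p

lemma IsIrrational.sub_ne_zero {f : LaurentSeries ℂ} (hf : IsIrrational f) (a : ℂ[X]) :
    f - seriesOf a ≠ 0 := by
  intro h
  exact hf a 1 one_ne_zero (by rw [map_one, one_mul]; exact sub_eq_zero.mp h)

/-- Irrationality passes to all complete quotients, so the expansion never stops and the convention
`0⁻¹ = 0` never intervenes. -/
lemma IsIrrational.inv_sub {f : LaurentSeries ℂ} (hf : IsIrrational f) (a : ℂ[X]) :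
    IsIrrational (f - seriesOf a)⁻¹ := by
  intro p q hq h
  have h1 : seriesOf q = seriesOf p * (f - seriesOf a) := by
    rw [← h, mul_assoc, inv_mul_cancel₀ (hf.sub_ne_zero a), mul_one]
  have hp : p ≠ 0 := by
    rintro rfl
    rw [map_zero, zero_mul] at h1
    exact seriesOf_ne_zero hq h1
  refine hf (q + p * a) p hp ?_
  rw [map_add, map_mul, h1]; ring

/-- Numerators of the convergents, shifted by one. -/
def convNum (f : LaurentSeries ℂ) : ℕ → ℂ[X]
  | 0 => 1
  | 1 => partialQuotient f 0
  | n + 2 => partialQuotient f (n + 1) * convNum f (n + 1) + convNum f n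

/-- Denominators of the convergents, shifted by one. -/
def convDen (f : LaurentSeries ℂ) : ℕ → ℂ[X]
  | 0 => 0
  | 1 => 1
  | n + 2 => partialQuotient f (n + 1) * convDen f (n + 1) + convDen f n

/-- The error `qₙ f - pₙ` of the convergents, shifted by one. -/
def convErr (f : LaurentSeries ℂ) (n : ℕ) : LaurentSeries ℂ :=
  seriesOf (convDen f n) * f - seriesOf (convNum f n)

/-- The degree of the denominator of the `n`-th convergent. -/
def denDeg (f : LaurentSeries ℂ) (n : ℕ) : ℕ :=
  ∑ i ∈ Finset.range n, (partialQuotient f (i + 1)).natDegree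

lemma denDeg_zero (f : LaurentSeries ℂ) : denDeg f 0 = 0 := rfl

lemma denDeg_succ (f : LaurentSeries ℂ) (n : ℕ) :
    denDeg f (n + 1) = denDeg f n + (partialQuotient f (n + 1)).natDegree :=
  Finset.sum_range_succ _ _

lemma conv_det (f : LaurentSeries ℂ) (n : ℕ) :
    convNum f (n + 1) * convDen f n - convNum f n * convDen f (n + 1) = (-1) ^ (n + 1) := by
  induction n with
  | zero => simp [convNum, convDen]
  | succ n ih =>
    rw [pow_succ, ← ih]
    simp only [convNum, convDen]
    ring

lemma isCoprime_conv (f : LaurentSeries ℂ) (n : ℕ) : IsCoprime (convNum f n) (convDen f n) := by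
  refine ⟨-(-1) ^ (n + 1) * convDen f (n + 1), (-1) ^ (n + 1) * convNum f (n + 1), ?_⟩
  have h := conv_det f n
  have h2 : ((-1 : ℂ[X]) ^ (n + 1)) * (-1) ^ (n + 1) = 1 := by rw [← mul_pow]; simp
  linear_combination (-1 : ℂ[X]) ^ (n + 1) * h + h2

/-! ### Degrees of convergents, their errors, and best approximation. -/

section ContinuedFraction

variable {f : LaurentSeries ℂ} (hf : IsIrrational f)
include hf

lemma isIrrational_completeQuotient (n : ℕ) : IsIrrational (completeQuotient f n) := by
  induction n with
  | zero => exact hf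
  | succ n ih => exact ih.inv_sub _

lemma completeQuotient_sub_ne_zero (n : ℕ) :
    completeQuotient f n - seriesOf (partialQuotient f n) ≠ 0 :=
  (isIrrational_completeQuotient hf n).sub_ne_zero _

lemma completeQuotient_succ_ne_zero (n : ℕ) : completeQuotient f (n + 1) ≠ 0 :=
  inv_ne_zero (completeQuotient_sub_ne_zero hf n)

lemma completeQuotient_succ_mul (n : ℕ) :
    completeQuotient f (n + 1) * (completeQuotient f n - seriesOf (partialQuotient f n)) = 1 :=
  inv_mul_cancel₀ (completeQuotient_sub_ne_zero hf n)

lemma order_completeQuotient_succ_neg (n : ℕ) : (completeQuotient f (n + 1)).order < 0 := by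
  have h := congrArg HahnSeries.order (completeQuotient_succ_mul hf n)
  rw [HahnSeries.order_mul (completeQuotient_succ_ne_zero hf n)
    (completeQuotient_sub_ne_zero hf n), HahnSeries.order_one] at h
  have h1 := (HahnSeries.zero_lt_orderTop_iff (completeQuotient_sub_ne_zero hf n)).mp
    (orderTop_sub_polyPart_pos _)
  omega

lemma natDegree_partialQuotient_succ (n : ℕ) :
    ((partialQuotient f (n + 1)).natDegree : ℤ) = -(completeQuotient f (n + 1)).order :=
  natDegree_polyPart (order_completeQuotient_succ_neg hf n).le

lemma natDegree_partialQuotient_succ_pos (n : ℕ) : 0 < (partialQuotient f (n + 1)).natDegree := by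
  have h1 := natDegree_partialQuotient_succ hf n
  have h2 := order_completeQuotient_succ_neg hf n
  omega

lemma denDeg_strictMono : StrictMono (denDeg f) :=
  strictMono_nat_of_lt_succ fun n => by
    rw [denDeg_succ]
    exact Nat.lt_add_of_pos_right (natDegree_partialQuotient_succ_pos hf n)

/-- The strict growth of degrees is carried along so that in the recurrence the product term
dominates and no cancellation occurs. -/
lemma convDen_spec (n : ℕ) : convDen f (n + 1) ≠ 0 ∧ (convDen f (n + 1)).natDegree = denDeg f n ∧
    (convDen f n).degree < (convDen f (n + 1)).degree := by
  induction n with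
  | zero => simp [convDen, denDeg_zero]
  | succ n ih =>
    obtain ⟨h0, h1, h2⟩ := ih
    have ha := natDegree_partialQuotient_succ_pos hf n
    have ha0 : partialQuotient f (n + 1) ≠ 0 := by rintro h; simp [h] at ha
    have hm : (convDen f (n + 1)).degree
        < (partialQuotient f (n + 1) * convDen f (n + 1)).degree := by
      rw [degree_eq_natDegree h0, degree_eq_natDegree (mul_ne_zero ha0 h0), natDegree_mul ha0 h0]
      exact_mod_cast Nat.lt_add_of_pos_left ha
    have hd : (convDen f (n + 2)).degree
        = (partialQuotient f (n + 1) * convDen f (n + 1)).degree :=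
      degree_add_eq_left_of_degree_lt (h2.trans hm)
    refine ⟨?_, ?_, hd ▸ hm⟩
    · intro h
      rw [show n + 1 + 1 = n + 2 from rfl] at h
      rw [h, degree_zero] at hd
      exact mul_ne_zero ha0 h0 (degree_eq_bot.mp hd.symm)
    · rw [natDegree_eq_of_degree_eq hd, natDegree_mul ha0 h0, h1, denDeg_succ, add_comm]

/-- Consecutive errors have ratio minus a complete quotient. This gives the orders of the errors,
and shows that equal complete quotients mean proportional pairs of errors. -/
lemma convErr_succ_mul (n : ℕ) :
    convErr f (n + 1) * completeQuotient f (n + 1) = -convErr f n := by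
  induction n with
  | zero =>
    have h := completeQuotient_succ_mul hf 0
    simp only [convErr, convDen, convNum, map_one, map_zero, zero_mul, one_mul, zero_sub, neg_neg]
    rw [mul_comm]
    exact h
  | succ n ih =>
    have h := completeQuotient_succ_mul hf (n + 1)
    have h2 : convErr f (n + 2)
        = seriesOf (partialQuotient f (n + 1)) * convErr f (n + 1) + convErr f n := by
      simp only [convErr, convDen, convNum, map_add, map_mul]
      ring
    rw [h2]
    linear_combination (-convErr f (n + 1)) * h + completeQuotient f (n + 2) * ih

lemma convErr_ne_zero (n : ℕ) : convErr f n ≠ 0 := by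
  cases n with
  | zero => simp [convErr, convDen, convNum]
  | succ n => exact sub_ne_zero.mpr (hf _ _ (convDen_spec hf n).1)

lemma order_convErr (n : ℕ) : (convErr f n).order = denDeg f n := by
  induction n with
  | zero => simp [convErr, convDen, convNum, denDeg_zero]
  | succ n ih =>
    have h := congrArg HahnSeries.order (convErr_succ_mul hf n)
    rw [HahnSeries.order_mul (convErr_ne_zero hf _) (completeQuotient_succ_ne_zero hf n),
      HahnSeries.order_neg, ih] at h
    rw [denDeg_succ]
    push_cast
    rw [natDegree_partialQuotient_succ hf n]
    omega

/-- Good rational approximations are convergents. -/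
theorem exists_denDeg_of_approx {p q : ℂ[X]} (hpq : IsCoprime p q) (hq : q ≠ 0)
    (h : (q.natDegree : ℤ) < (seriesOf p - seriesOf q * f).order) :
    ∃ n, denDeg f n = q.natDegree ∧
      (denDeg f (n + 1) : ℤ) = (seriesOf p - seriesOf q * f).order := by
  -- The convergent to compare with is the last one whose denominator has degree at most deg q.
  obtain ⟨n, hn1, hn2⟩ : ∃ n, denDeg f n ≤ q.natDegree ∧ q.natDegree < denDeg f (n + 1) := by
    have hex : ∃ m, q.natDegree < denDeg f m :=
      ⟨q.natDegree + 1, (denDeg_strictMono hf).le_apply⟩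
    have h0 : Nat.find hex ≠ 0 := fun h0 => by
      have := Nat.find_spec hex
      rw [h0, denDeg_zero] at this
      omega
    obtain ⟨k, hk⟩ := Nat.exists_eq_succ_of_ne_zero h0
    refine ⟨k, ?_, by simpa [hk] using Nat.find_spec hex⟩
    exact not_lt.mp (Nat.find_min hex (by omega))
  obtain ⟨hD0, hDdeg, -⟩ := convDen_spec hf n
  have he0 : seriesOf p - seriesOf q * f ≠ 0 := sub_ne_zero.mpr (hf p q hq).symm
  -- With P/Q that convergent, pQ - qP = (p - qf)Q + q(Qf - P). Both terms have positive order, so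
  -- this polynomial vanishes.
  have hzero : p * convDen f (n + 1) - q * convNum f (n + 1) = 0 := by
    apply eq_zero_of_orderTop_seriesOf_pos
    have : seriesOf (p * convDen f (n + 1) - q * convNum f (n + 1))
        = (seriesOf p - seriesOf q * f) * seriesOf (convDen f (n + 1))
          + seriesOf q * convErr f (n + 1) := by
      simp only [convErr, map_sub, map_mul]; ring
    rw [this]
    refine lt_of_lt_of_le (lt_min ?_ ?_) HahnSeries.min_orderTop_le_orderTop_add
    · rw [HahnSeries.zero_lt_orderTop_iff (mul_ne_zero he0 (seriesOf_ne_zero hD0)),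
        HahnSeries.order_mul he0 (seriesOf_ne_zero hD0), order_seriesOf, hDdeg]
      omega
    · rw [HahnSeries.zero_lt_orderTop_iff
        (mul_ne_zero (seriesOf_ne_zero hq) (convErr_ne_zero hf _)),
        HahnSeries.order_mul (seriesOf_ne_zero hq) (convErr_ne_zero hf _), order_seriesOf,
        order_convErr hf]
      omega
  have hassoc : Associated q (convDen f (n + 1)) := by
    refine associated_of_dvd_dvd (hpq.symm.dvd_of_dvd_mul_left ⟨convNum f (n + 1), ?_⟩)
      ((isCoprime_conv f (n + 1)).symm.dvd_of_dvd_mul_left ⟨p, ?_⟩)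
    · linear_combination hzero
    · linear_combination -hzero
  obtain ⟨u, hu⟩ := hassoc
  have hp : p * u = convNum f (n + 1) := by
    apply mul_left_cancel₀ hq
    rw [← hu] at hzero
    linear_combination hzero
  have herr : convErr f (n + 1) = -(seriesOf p - seriesOf q * f) * seriesOf u := by
    simp only [convErr, ← hu, ← hp, map_mul]; ring
  have hu0 : (u : ℂ[X]).natDegree = 0 := natDegree_coe_units u
  refine ⟨n, ?_, ?_⟩
  · rw [← hDdeg, ← hu, natDegree_mul hq u.ne_zero, hu0, add_zero]
  · rw [← order_convErr hf, herr, HahnSeries.order_mul (neg_ne_zero.mpr he0)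
      (seriesOf_ne_zero u.ne_zero), HahnSeries.order_neg, order_seriesOf, hu0]
    simp

end ContinuedFraction

/-- An irrational series is determined by its partial quotients. -/
theorem completeQuotient_eq_of_partialQuotient_eq {f : LaurentSeries ℂ} (hf : IsIrrational f)
    {i j : ℕ} (h : ∀ n, partialQuotient f (i + n) = partialQuotient f (j + n)) :
    completeQuotient f i = completeQuotient f j := by
  -- With equal partial quotients, x - y = -(x' - y')/(x'y') for the next complete quotients x', y',
  -- which have poles. Each step back thus gains at least 2 in the order of the difference; the
  -- bound must therefore be uniform in n.
  have key : ∀ k n : ℕ, (((2 * k : ℕ) : ℤ) : WithTop ℤ)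
      ≤ (completeQuotient f (i + n) - completeQuotient f (j + n)).orderTop := by
    intro k
    induction k with
    | zero =>
      intro n
      have : completeQuotient f (i + n) - completeQuotient f (j + n)
          = (completeQuotient f (i + n) - seriesOf (partialQuotient f (i + n)))
          - (completeQuotient f (j + n) - seriesOf (partialQuotient f (j + n))) := by
        rw [h n]; ring
      rw [this]
      refine (le_min ?_ ?_).trans HahnSeries.min_orderTop_le_orderTop_sub
      · exact (orderTop_sub_polyPart_pos _).le
      · exact (orderTop_sub_polyPart_pos _).le
    | succ k ih =>
      intro n
      have h1 := completeQuotient_succ_mul hf (i + n)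
      have h2 := completeQuotient_succ_mul hf (j + n)
      rw [h n] at h1
      set x := completeQuotient f (i + n)
      set y := completeQuotient f (j + n)
      set x' := completeQuotient f (i + n + 1) with hx'
      set y' := completeQuotient f (j + n + 1) with hy'
      have hrel : (x - y) * (x' * y') = -(x' - y') := by
        linear_combination y' * h1 - x' * h2
      by_cases hxy : x - y = 0
      · rw [hxy, HahnSeries.orderTop_zero]; exact le_top
      have hx0 : x' ≠ 0 := completeQuotient_succ_ne_zero hf _
      have hy0 : y' ≠ 0 := completeQuotient_succ_ne_zero hf _
      have hxy' : x' - y' ≠ 0 := by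
        intro h0
        rw [h0, neg_zero] at hrel
        exact mul_ne_zero hxy (mul_ne_zero hx0 hy0) hrel
      have ho := congrArg HahnSeries.order hrel
      rw [HahnSeries.order_mul hxy (mul_ne_zero hx0 hy0), HahnSeries.order_mul hx0 hy0,
        HahnSeries.order_neg] at ho
      have hxo : x'.order < 0 := order_completeQuotient_succ_neg hf _
      have hyo : y'.order < 0 := order_completeQuotient_succ_neg hf _
      have := ih (n + 1)
      rw [← add_assoc, ← add_assoc, ← hx', ← hy', ← HahnSeries.order_eq_orderTop_of_ne_zero hxy',
        WithTop.coe_le_coe] at this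
      rw [← HahnSeries.order_eq_orderTop_of_ne_zero hxy, WithTop.coe_le_coe]
      push_cast at this ⊢
      omega
  by_contra hne
  have hne' := sub_ne_zero.mpr hne
  have := key ((completeQuotient f i - completeQuotient f j).order.toNat + 1) 0
  rw [add_zero, add_zero, ← HahnSeries.order_eq_orderTop_of_ne_zero hne',
    WithTop.coe_le_coe] at this
  push_cast at this
  omega

/-- If the partial quotients of `√D` are eventually periodic, then `D` is Pellian. -/
theorem isPellian_of_isEventuallyPeriodic {D : ℂ[X]} (hD : ¬ IsUnit D) {f : LaurentSeries ℂ}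
    (hfD : f ^ 2 = seriesOf D) (hf : IsIrrational f)
    (h : IsEventuallyPeriodic (partialQuotient f)) : IsPellian D := by
  obtain ⟨N, m, hm, hper⟩ := h
  have hα : completeQuotient f (N + 1 + m) = completeQuotient f (N + 1) :=
    completeQuotient_eq_of_partialQuotient_eq hf fun n => by
      have := hper (N + 1 + n) (by omega)
      rwa [show N + 1 + m + n = N + 1 + n + m by ring]
  have e1 := convErr_succ_mul hf N
  have e2 := convErr_succ_mul hf (N + m)
  rw [show N + m + 1 = N + 1 + m by ring, hα] at e2
  have d1 := conv_det f N
  have d2 := conv_det f (N + m)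
  rw [show N + m + 1 = N + 1 + m by ring] at d2
  have hα0 : completeQuotient f (N + 1) ≠ 0 := completeQuotient_succ_ne_zero hf N
  -- The two pairs of consecutive errors differ by a factor λ. Below, up to sign, λ = X - Yf with X
  -- = qr' - q'r and Y = qs' - q's; its norm X² - DY² is a product of two convergent determinants,
  -- hence ±1.
  have hprop : convErr f (N + 1 + m) * convErr f N = convErr f (N + 1) * convErr f (N + m) := by
    apply mul_right_cancel₀ hα0
    linear_combination convErr f N * e2 - convErr f (N + m) * e1
  have hE0 := convErr_ne_zero hf N
  set p := convNum f (N + 1)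
  set p' := convNum f N
  set q := convDen f (N + 1)
  set q' := convDen f N
  set r := convNum f (N + 1 + m)
  set r' := convNum f (N + m)
  set s := convDen f (N + 1 + m)
  set s' := convDen f (N + m)
  have he : convErr f (N + 1) = seriesOf q * f - seriesOf p := rfl
  have he' : convErr f N = seriesOf q' * f - seriesOf p' := rfl
  have hE : convErr f (N + 1 + m) = seriesOf s * f - seriesOf r := rfl
  have hE' : convErr f (N + m) = seriesOf s' * f - seriesOf r' := rfl
  have hmain : (seriesOf q * convErr f (N + m) - seriesOf q' * convErr f (N + 1 + m)) * f
      = seriesOf p * convErr f (N + m) - seriesOf p' * convErr f (N + 1 + m) := by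
    apply mul_right_cancel₀ hE0
    have : seriesOf q * convErr f N * f - seriesOf q' * convErr f (N + 1) * f
        = seriesOf p * convErr f N - seriesOf p' * convErr f (N + 1) := by
      rw [he, he']; ring
    linear_combination convErr f (N + m) * this - (seriesOf q' * f - seriesOf p') * hprop
  have hlin : seriesOf (q * r' - q' * r + (p * s' - p' * s)) * f
      = seriesOf ((q * s' - q' * s) * D + (p * r' - p' * r)) := by
    rw [hE, hE'] at hmain
    simp only [map_add, map_sub, map_mul, ← hfD]
    linear_combination -hmain
  -- Irrationality of f separates the coefficients of f and 1 in `hlin`.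
  have hX1 : q * r' - q' * r + (p * s' - p' * s) = 0 := by
    by_contra h0
    exact hf _ _ h0 hlin
  have hX2 : (q * s' - q' * s) * D + (p * r' - p' * r) = 0 := by
    rw [hX1, map_zero, zero_mul] at hlin
    exact seriesOf_injective (by rw [← hlin, map_zero])
  have hnorm : (q * r' - q' * r) ^ 2 - D * (q * s' - q' * s) ^ 2
      = (-1) ^ (N + 1) * (-1) ^ (N + 1 + m) := by
    rw [← d1, ← d2]
    linear_combination (q * r' - q' * r) * hX1 - (q * s' - q' * s) * hX2
  -- If Y = 0, then λ is a polynomial. Multiplying by it cannot raise the order of a series, yet the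
  -- error N + m has larger order than the error N.
  have hY0 : q * s' - q' * s ≠ 0 := by
    intro h0
    have h1 : (-1) ^ (N + 1) * convErr f (N + m) = -seriesOf (q * r' - q' * r) * convErr f N := by
      have hd : (seriesOf p * seriesOf q' - seriesOf p' * seriesOf q) = (-1) ^ (N + 1) := by
        rw [← map_mul, ← map_mul, ← map_sub, d1]; simp
      have h2 : seriesOf q * seriesOf s' - seriesOf q' * seriesOf s = 0 := by
        rw [← map_mul, ← map_mul, ← map_sub, h0, map_zero]
      have h3 : seriesOf q * convErr f N - seriesOf q' * convErr f (N + 1)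
          = seriesOf p * seriesOf q' - seriesOf p' * seriesOf q := by
        rw [he, he']; ring
      have h4 : seriesOf q * convErr f (N + m) - seriesOf q' * convErr f (N + 1 + m)
          = -seriesOf (q * r' - q' * r) := by
        rw [hE, hE']; simp only [map_sub, map_mul]; linear_combination f * h2
      rw [← hd, ← h3, ← h4]
      linear_combination seriesOf q' * hprop
    have hX0 : q * r' - q' * r ≠ 0 := by
      intro h2
      rw [h2, map_zero, neg_zero, zero_mul] at h1
      exact mul_ne_zero (pow_ne_zero _ (neg_ne_zero.mpr one_ne_zero)) (convErr_ne_zero hf _) h1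
    have ho := congrArg HahnSeries.order h1
    rw [HahnSeries.order_mul (pow_ne_zero _ (neg_ne_zero.mpr one_ne_zero)) (convErr_ne_zero hf _),
      HahnSeries.order_mul (neg_ne_zero.mpr (seriesOf_ne_zero hX0)) hE0, HahnSeries.order_neg,
      order_seriesOf, HahnSeries.order_pow, HahnSeries.order_neg, HahnSeries.order_one,
      order_convErr hf, order_convErr hf] at ho
    have := denDeg_strictMono hf (show N < N + m by omega)
    simp at ho
    omega
  have hX0 : q * r' - q' * r ≠ 0 := by
    intro h0
    rw [h0] at hnorm
    apply hD
    refine IsUnit.of_mul_eq_one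
      (-(q * s' - q' * s) ^ 2 * ((-1) ^ (N + 1) * (-1) ^ (N + 1 + m))) ?_
    have : ((-1 : ℂ[X]) ^ (N + 1) * (-1) ^ (N + 1 + m)) ^ 2 = 1 := by
      rw [mul_pow, ← pow_mul, ← pow_mul]; simp
    linear_combination ((-1) ^ (N + 1) * (-1) ^ (N + 1 + m)) * hnorm + this
  rw [← pow_add] at hnorm
  rcases neg_one_pow_eq_or ℂ[X] (N + 1 + (N + 1 + m)) with h1 | h1
  · exact ⟨_, _, hX0, hY0, hnorm.trans h1⟩
  -- A solution of norm -1 becomes one of norm 1 after multiplication by i.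
  · have hI : (C Complex.I : ℂ[X]) ^ 2 = -1 := by
      rw [← C_pow, Complex.I_sq]; simp
    have hI0 : (C Complex.I : ℂ[X]) ≠ 0 := C_ne_zero.mpr Complex.I_ne_zero
    refine ⟨C Complex.I * (q * r' - q' * r), C Complex.I * (q * s' - q' * s),
      mul_ne_zero hI0 hX0, mul_ne_zero hI0 hY0, ?_⟩
    rw [h1] at hnorm
    linear_combination (-1) * hnorm +
      ((q * r' - q' * r) ^ 2 - D * (q * s' - q' * s) ^ 2) * hI

/-! ### Chebyshev polynomials at `(x + x⁻¹) / 2` -/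

section Chebyshev

variable {K : Type*} [Field K] [Algebra ℂ K] {x t : K}

/-- The field K stays general because these identities are needed both for complex values of s and
for s as a Laurent series. Integer indices remove any comparison of n with deg A. -/
lemma two_mul_aeval_T (hx : x ≠ 0) (ht : 2 * t = x + x⁻¹) (k : ℤ) :
    2 * aeval t (Chebyshev.T ℂ k) = x ^ k + x ^ (-k) := by
  induction k using Chebyshev.induct with
  | zero => simp; norm_num
  | one => simpa using ht
  | add_two n h1 h0 =>
    rw [Chebyshev.T_add_two]
    simp only [map_sub, map_mul, aeval_X, map_ofNat]
    have e1 : x ^ ((n : ℤ) + 2) = x ^ ((n : ℤ) + 1) * x := by rw [← zpow_add_one₀ hx]; ring_nf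
    have e2 : x ^ (n : ℤ) = x ^ ((n : ℤ) + 1) * x⁻¹ := by rw [← zpow_sub_one₀ hx]; ring_nf
    have e3 : x ^ (-((n : ℤ) + 2)) = x ^ (-((n : ℤ) + 1)) * x⁻¹ := by
      rw [← zpow_sub_one₀ hx]; ring_nf
    have e4 : x ^ (-(n : ℤ)) = x ^ (-((n : ℤ) + 1)) * x := by rw [← zpow_add_one₀ hx]; ring_nf
    rw [e1, e3]
    rw [e2, e4] at h0
    linear_combination 2 * t * h1 - h0 + (x ^ ((n : ℤ) + 1) + x ^ (-((n : ℤ) + 1))) * ht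
  | neg_add_one n h1 h0 =>
    rw [Chebyshev.T_sub_one]
    simp only [map_sub, map_mul, aeval_X, map_ofNat]
    have e1 : x ^ (-(n : ℤ) - 1) = x ^ (-(n : ℤ)) * x⁻¹ := by rw [← zpow_sub_one₀ hx]
    have e2 : x ^ (-(n : ℤ) + 1) = x ^ (-(n : ℤ)) * x := by rw [← zpow_add_one₀ hx]
    have e3 : x ^ (-(-(n : ℤ) - 1)) = x ^ (- -(n : ℤ)) * x := by
      rw [← zpow_add_one₀ hx]; ring_nf
    have e4 : x ^ (-(-(n : ℤ) + 1)) = x ^ (- -(n : ℤ)) * x⁻¹ := by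
      rw [← zpow_sub_one₀ hx]; ring_nf
    rw [e1, e3]
    rw [e2, e4] at h0
    linear_combination 2 * t * h1 - h0 + (x ^ (-(n : ℤ)) + x ^ (- -(n : ℤ))) * ht

lemma sub_inv_mul_aeval_U (hx : x ≠ 0) (ht : 2 * t = x + x⁻¹) (k : ℤ) :
    (x - x⁻¹) * aeval t (Chebyshev.U ℂ (k - 1)) = x ^ k - x ^ (-k) := by
  induction k using Chebyshev.induct with
  | zero => simp
  | one => simp
  | add_two n h1 h0 =>
    rw [show (n : ℤ) + 2 - 1 = (n - 1 : ℤ) + 2 by ring, Chebyshev.U_add_two]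
    rw [show (n : ℤ) + 1 - 1 = (n - 1 : ℤ) + 1 by ring] at h1
    simp only [map_sub, map_mul, aeval_X, map_ofNat]
    have e1 : x ^ ((n : ℤ) + 2) = x ^ ((n : ℤ) + 1) * x := by rw [← zpow_add_one₀ hx]; ring_nf
    have e2 : x ^ (n : ℤ) = x ^ ((n : ℤ) + 1) * x⁻¹ := by rw [← zpow_sub_one₀ hx]; ring_nf
    have e3 : x ^ (-((n : ℤ) + 2)) = x ^ (-((n : ℤ) + 1)) * x⁻¹ := by
      rw [← zpow_sub_one₀ hx]; ring_nf
    have e4 : x ^ (-(n : ℤ)) = x ^ (-((n : ℤ) + 1)) * x := by rw [← zpow_add_one₀ hx]; ring_nf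
    rw [e1, e3]
    rw [e2, e4] at h0
    linear_combination 2 * t * h1 - h0 + (x ^ ((n : ℤ) + 1) - x ^ (-((n : ℤ) + 1))) * ht
  | neg_add_one n h1 h0 =>
    rw [Chebyshev.U_sub_one]
    rw [show -(n : ℤ) + 1 - 1 = (-n - 1 : ℤ) + 1 by ring] at h0
    simp only [map_sub, map_mul, aeval_X, map_ofNat]
    have e1 : x ^ (-(n : ℤ) - 1) = x ^ (-(n : ℤ)) * x⁻¹ := by rw [← zpow_sub_one₀ hx]
    have e2 : x ^ (-(n : ℤ) + 1) = x ^ (-(n : ℤ)) * x := by rw [← zpow_add_one₀ hx]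
    have e3 : x ^ (-(-(n : ℤ) - 1)) = x ^ (- -(n : ℤ)) * x := by
      rw [← zpow_add_one₀ hx]; ring_nf
    have e4 : x ^ (-(-(n : ℤ) + 1)) = x ^ (- -(n : ℤ)) * x⁻¹ := by
      rw [← zpow_sub_one₀ hx]; ring_nf
    rw [e1, e3]
    rw [e2, e4] at h0
    linear_combination 2 * t * h1 - h0 + (x ^ (-(n : ℤ)) - x ^ (- -(n : ℤ))) * ht

/-- The polynomial `p` in `t = (s + s⁻¹) / 2` with `2 p = sⁿ A(s⁻¹) + s⁻ⁿ A(s)`. -/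
def symmPart (A : ℂ[X]) (n : ℤ) : ℂ[X] :=
  ∑ j ∈ Finset.range (A.natDegree + 1), C (A.coeff j) * Chebyshev.T ℂ (n - j)

/-- The polynomial `q` in `t = (s + s⁻¹) / 2` with `(s - s⁻¹) q = sⁿ A(s⁻¹) - s⁻ⁿ A(s)`. -/
def antisymmPart (A : ℂ[X]) (n : ℤ) : ℂ[X] :=
  ∑ j ∈ Finset.range (A.natDegree + 1), C (A.coeff j) * Chebyshev.U ℂ (n - j - 1)

lemma zpow_mul_aeval_inv (hx : x ≠ 0) (A : ℂ[X]) (n : ℤ) :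
    x ^ n * aeval x⁻¹ A
      = ∑ j ∈ Finset.range (A.natDegree + 1), algebraMap ℂ K (A.coeff j) * x ^ (n - j) := by
  rw [aeval_eq_sum_range, Finset.mul_sum]
  refine Finset.sum_congr rfl fun j _ => ?_
  rw [Algebra.smul_def, zpow_sub₀ hx, zpow_natCast, inv_pow, div_eq_mul_inv]
  ring

lemma zpow_mul_aeval (hx : x ≠ 0) (A : ℂ[X]) (n : ℤ) :
    x ^ (-n) * aeval x A
      = ∑ j ∈ Finset.range (A.natDegree + 1), algebraMap ℂ K (A.coeff j) * x ^ (-(n - j)) := by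
  rw [aeval_eq_sum_range, Finset.mul_sum]
  refine Finset.sum_congr rfl fun j _ => ?_
  rw [Algebra.smul_def, neg_sub, sub_eq_neg_add, zpow_add₀ hx, zpow_natCast]
  ring

lemma two_mul_aeval_symmPart (hx : x ≠ 0) (ht : 2 * t = x + x⁻¹) (A : ℂ[X]) (n : ℤ) :
    2 * aeval t (symmPart A n) = x ^ n * aeval x⁻¹ A + x ^ (-n) * aeval x A := by
  rw [zpow_mul_aeval_inv hx, zpow_mul_aeval hx, ← Finset.sum_add_distrib, symmPart, map_sum,
    Finset.mul_sum]
  refine Finset.sum_congr rfl fun j _ => ?_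
  rw [map_mul, aeval_C]
  linear_combination algebraMap ℂ K (A.coeff j) * two_mul_aeval_T hx ht (n - j)

lemma sub_inv_mul_aeval_antisymmPart (hx : x ≠ 0) (ht : 2 * t = x + x⁻¹) (A : ℂ[X]) (n : ℤ) :
    (x - x⁻¹) * aeval t (antisymmPart A n) = x ^ n * aeval x⁻¹ A - x ^ (-n) * aeval x A := by
  rw [zpow_mul_aeval_inv hx, zpow_mul_aeval hx, ← Finset.sum_sub_distrib, antisymmPart, map_sum,
    Finset.mul_sum]
  refine Finset.sum_congr rfl fun j _ => ?_
  rw [map_mul, aeval_C]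
  linear_combination algebraMap ℂ K (A.coeff j) * sub_inv_mul_aeval_U hx ht (n - j)

end Chebyshev

/-! ### The polynomials `polyD b` -/

lemma exists_joukowsky (t : ℂ) : ∃ s : ℂ, s ≠ 0 ∧ 2 * t = s + s⁻¹ := by
  obtain ⟨w, hw⟩ := IsAlgClosed.exists_pow_nat_eq (t ^ 2 - 1) two_pos
  have h : (t + w) * (t - w) = 1 := by linear_combination -hw
  refine ⟨t + w, left_ne_zero_of_mul_eq_one h, ?_⟩
  rw [inv_eq_of_mul_eq_one_right h]; ring

section PolyD

variable {g : ℕ} {b : Fin g → ℂˣ}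

lemma two_mul_rho (i : Fin g) : 2 * rho b i = (b i : ℂ) + (b i : ℂ)⁻¹ := by
  rw [rho, Units.val_inv_eq_inv_val]; ring

lemma IsAdmissible.ne_inv (hb : IsAdmissible b) (i j : Fin g) : (b i : ℂ) ≠ (b j : ℂ)⁻¹ := by
  rw [← Units.val_inv_eq_inv_val, ne_eq, Units.val_inj]
  exact hb.2 i j

lemma IsAdmissible.rho_injective (hb : IsAdmissible b) : Function.Injective (rho b) := by
  intro i j h
  have hi := (b i).ne_zero
  have hj := (b j).ne_zero
  have h2 : (b i : ℂ) + (b i : ℂ)⁻¹ = (b j : ℂ) + (b j : ℂ)⁻¹ := by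
    rw [← two_mul_rho, ← two_mul_rho, h]
  have h3 : ((b i : ℂ) - b j) * ((b i : ℂ) - (b j : ℂ)⁻¹) = 0 := by
    field_simp at h2 ⊢
    linear_combination h2
  rcases mul_eq_zero.mp h3 with h4 | h4
  · exact hb.1 (Units.ext (sub_eq_zero.mp h4))
  · exact absurd (sub_eq_zero.mp h4) (hb.ne_inv i j)

variable (b) in
/-- `(t - ρ₁) ⋯ (t - ρ_g)`. -/
def polyR : ℂ[X] := ∏ i, (X - C (rho b i))

lemma polyR_monic : (polyR b).Monic := monic_prod_X_sub_C _ _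

lemma natDegree_polyR : (polyR b).natDegree = g := by
  simp [polyR, natDegree_prod_of_monic _ _ fun i _ => monic_X_sub_C (rho b i)]

lemma polyD_eq : polyD b = (X ^ 2 - 1) * polyR b ^ 2 := rfl

lemma natDegree_X_sq_sub_one : (X ^ 2 - 1 : ℂ[X]).natDegree = 2 := by
  simpa using natDegree_X_pow_sub_C (R := ℂ) (n := 2) (r := 1)

lemma X_sq_sub_one_ne_zero : (X ^ 2 - 1 : ℂ[X]) ≠ 0 := fun h => by
  simpa [h] using natDegree_X_sq_sub_one

lemma natDegree_polyD : (polyD b).natDegree = 2 * (g + 1) := by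
  rw [polyD_eq, natDegree_mul X_sq_sub_one_ne_zero (pow_ne_zero _ polyR_monic.ne_zero),
    natDegree_pow, natDegree_polyR, natDegree_X_sq_sub_one]
  ring

lemma not_isUnit_polyD : ¬ IsUnit (polyD b) := fun h => by
  have := natDegree_eq_zero_of_isUnit h
  rw [natDegree_polyD] at this
  omega

lemma polyR_eval_rho (i : Fin g) : (polyR b).eval (rho b i) = 0 := by
  rw [polyR, eval_prod]
  exact Finset.prod_eq_zero (Finset.mem_univ i) (by simp)

lemma polyR_dvd (hb : IsAdmissible b) {q : ℂ[X]} (h : ∀ i, q.eval (rho b i) = 0) :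
    polyR b ∣ q :=
  Finset.prod_dvd_of_coprime
    (fun _ _ _ _ hij => pairwise_coprime_X_sub_C hb.rho_injective hij)
    fun i _ => dvd_iff_isRoot.mpr (h i)

/-- `t² - 1` is not a square in `ℂ(t)`. -/
lemma sq_ne_X_sq_sub_one_mul_sq {x y : ℂ[X]} (hy : y ≠ 0) : x ^ 2 ≠ (X ^ 2 - 1) * y ^ 2 := by
  intro h
  obtain ⟨c, rfl⟩ : y ∣ x := (IsIntegrallyClosed.pow_dvd_pow_iff two_ne_zero).mp ⟨X ^ 2 - 1, by rw [h, mul_comm]⟩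
  have hc : c ^ 2 = X ^ 2 - 1 := by
    apply mul_left_cancel₀ (pow_ne_zero 2 hy)
    linear_combination h
  -- A square vanishing at 1 has zero derivative there, but t² - 1 has derivative 2.
  have h1 : c.eval 1 = 0 := by
    have := congrArg (eval 1) hc
    simpa using this
  have h2 := congrArg (fun p => eval 1 (derivative p)) hc
  simp [derivative_pow, h1] at h2

lemma isIrrational_of_sq_eq_polyD {f : LaurentSeries ℂ} (hf : f ^ 2 = seriesOf (polyD b)) :
    IsIrrational f := by
  intro p q hq h
  refine sq_ne_X_sq_sub_one_mul_sq (x := p) (mul_ne_zero hq (polyR_monic (b := b)).ne_zero) ?_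
  apply seriesOf_injective
  rw [map_pow, ← h, mul_pow, hf, ← map_pow, ← map_mul, polyD_eq]
  ring_nf

lemma order_of_sq_eq_polyD {f : LaurentSeries ℂ} (hf : f ^ 2 = seriesOf (polyD b)) :
    f.order = -((g : ℤ) + 1) := by
  have h := congrArg HahnSeries.order hf
  rw [HahnSeries.order_pow, order_seriesOf, natDegree_polyD] at h
  simp at h
  omega

/-- The series `√(t² - 1)`. -/
lemma exists_sqrt_X_sq_sub_one : ∃ u : LaurentSeries ℂ, u ^ 2 = seriesOf (X ^ 2 - 1) := by
  -- The root is built as t · √(1 + t⁻¹) · √(1 - t⁻¹).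
  set B : PowerSeries ℂ := PowerSeries.binomialSeries ℂ (1 / 2 : ℂ) with hB
  have h1 : B * B = 1 + PowerSeries.X := by
    rw [hB, ← PowerSeries.binomialSeries_add, add_halves]
    simpa using PowerSeries.binomialSeries_nat (R := ℂ) (A := ℂ) 1
  have h2 : PowerSeries.rescale (-1) B * PowerSeries.rescale (-1) B = 1 - PowerSeries.X := by
    rw [← map_mul, h1, map_add, map_one, PowerSeries.rescale_X]
    simp [sub_eq_add_neg]
  have h3 : HahnSeries.ofPowerSeries ℤ ℂ (B * PowerSeries.rescale (-1) B) ^ 2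
      = 1 - HahnSeries.single 2 1 := by
    rw [← map_pow, show (B * PowerSeries.rescale (-1) B) ^ 2 = 1 - PowerSeries.X ^ 2 by
      linear_combination PowerSeries.rescale (-1) B * PowerSeries.rescale (-1) B * h1
        + (1 + PowerSeries.X) * h2]
    rw [map_sub, map_one, HahnSeries.ofPowerSeries_X_pow]
    rfl
  refine ⟨HahnSeries.single (-1) 1 *
    HahnSeries.ofPowerSeries ℤ ℂ (B * PowerSeries.rescale (-1) B), ?_⟩
  rw [mul_pow, h3, mul_sub, HahnSeries.single_pow, HahnSeries.single_mul_single]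
  simp [seriesOf]

variable (b) in
lemma exists_sqrt_polyD : ∃ f : LaurentSeries ℂ, f ^ 2 = seriesOf (polyD b) := by
  obtain ⟨u, hu⟩ := exists_sqrt_X_sq_sub_one
  exact ⟨u * seriesOf (polyR b), by rw [mul_pow, hu, polyD_eq, map_mul, map_pow]⟩

end PolyD

/-! ### Convergents coming from multiples of `δ` -/

lemma seriesOf_eq_aeval (p : ℂ[X]) : seriesOf p = aeval (seriesOf X) p := by
  simp [seriesOf]

lemma orderTop_aeval_nonneg {y : LaurentSeries ℂ} (hy : y.order = 1) (B : ℂ[X]) :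
    0 ≤ (aeval y B).orderTop := by
  have hy0 : y ≠ 0 := by rintro rfl; simp at hy
  induction B using Polynomial.induction_on' with
  | add p q hp hq =>
    rw [map_add]
    exact (le_min hp hq).trans HahnSeries.min_orderTop_le_orderTop_add
  | monomial n a =>
    rw [aeval_monomial, algebraMap_laurentSeries, HahnSeries.zero_le_orderTop_iff]
    by_cases ha : a = 0
    · simp [ha]
    rw [HahnSeries.order_mul (by simpa using ha) (pow_ne_zero _ hy0), HahnSeries.order_pow, hy,
      HahnSeries.order_C]
    simp

/-- All terms but the constant one have positive order. The case of a pole follows by reversing the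
coefficients. -/
lemma aeval_of_order_one {y : LaurentSeries ℂ} (hy : y.order = 1) {A : ℂ[X]}
    (hA : A.coeff 0 ≠ 0) : aeval y A ≠ 0 ∧ (aeval y A).order = 0 := by
  have h0 : (aeval y A).orderTop = 0 := by
    rw [← divX_mul_X_add A, map_add, map_mul, aeval_X, aeval_C, algebraMap_laurentSeries]
    have h2 : (HahnSeries.C (Γ := ℤ) (A.coeff 0)).orderTop = 0 := by
      rw [HahnSeries.C_apply]
      exact HahnSeries.orderTop_single hA
    have hy0 : y ≠ 0 := by rintro rfl; simp at hy
    rw [HahnSeries.orderTop_add_eq_right, h2]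
    rw [h2, HahnSeries.orderTop_mul, ← HahnSeries.order_eq_orderTop_of_ne_zero hy0, hy]
    exact lt_of_lt_of_le (WithTop.coe_pos.mpr one_pos)
      (le_add_of_nonneg_left (orderTop_aeval_nonneg hy _))
  have hne : aeval y A ≠ 0 := by
    rw [← HahnSeries.orderTop_ne_top, h0]
    exact WithTop.zero_ne_top
  refine ⟨hne, ?_⟩
  rw [← HahnSeries.order_eq_orderTop_of_ne_zero hne] at h0
  exact_mod_cast h0

lemma aeval_of_order_neg_one {x : LaurentSeries ℂ} (hx : x.order = -1) {A : ℂ[X]}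
    (hA : A ≠ 0) : aeval x A ≠ 0 ∧ (aeval x A).order = -(A.natDegree : ℤ) := by
  have hx0 : x ≠ 0 := by rintro rfl; simp at hx
  have hxi : x⁻¹.order = 1 := by
    have h := congrArg HahnSeries.order (mul_inv_cancel₀ hx0)
    rw [HahnSeries.order_mul hx0 (inv_ne_zero hx0), HahnSeries.order_one] at h
    omega
  obtain ⟨h1, h2⟩ := aeval_of_order_one hxi (A := A.reverse)
    (by rw [coeff_zero_reverse]; exact leadingCoeff_ne_zero.mpr hA)
  have h3 : aeval x⁻¹ A.reverse * x ^ A.natDegree = aeval x A := by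
    let := invertibleOfNonzero hx0
    have := eval₂_reverse_mul_pow (algebraMap ℂ (LaurentSeries ℂ)) x A
    rwa [invOf_eq_inv] at this
  rw [← h3]
  refine ⟨mul_ne_zero h1 (pow_ne_zero _ hx0), ?_⟩
  rw [HahnSeries.order_mul h1 (pow_ne_zero _ hx0), HahnSeries.order_pow, h2, hx]
  simp

/-- If `nδ ∈ W_l`, as witnessed by the polynomial `A` of degree `l`, then `√D` has two consecutive
convergents whose denominators have degrees `n - g - 1` and `n - l`. -/
theorem exists_denDeg_of_witness {g : ℕ} {b : Fin g → ℂˣ} (hb : IsAdmissible b)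
    {A : ℂ[X]} {n : ℕ} (hA0 : A.coeff 0 ≠ 0) (hlg : A.natDegree ≤ g) (hln : A.natDegree < n)
    (hA : ∀ i, (b i : ℂ) ^ (2 * n) * A.eval (b i : ℂ)⁻¹ = A.eval (b i : ℂ))
    (hcop : ∀ s, s ≠ 0 → A.eval s = 0 → A.eval s⁻¹ ≠ 0)
    {f : LaurentSeries ℂ} (hf : f ^ 2 = seriesOf (polyD b)) :
    ∃ k, denDeg f k + (g + 1) = n ∧ denDeg f (k + 1) + A.natDegree = n := by
  have hirr := isIrrational_of_sq_eq_polyD hf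
  have hfo := order_of_sq_eq_polyD hf
  have hf0 : f ≠ 0 := by rintro rfl; simp at hfo; omega
  have hAne : A ≠ 0 := by rintro rfl; simp at hA0
  have hR0 := seriesOf_ne_zero (polyR_monic (b := b)).ne_zero
  -- the coordinate `x` on the conic, normalized to have a pole of order one
  obtain ⟨x, ε, hε, hx, hx0, hsum, hdiff⟩ : ∃ x : LaurentSeries ℂ, ∃ ε : ℂ, ε ^ 2 = 1 ∧
      x.order = -1 ∧ x ≠ 0 ∧ 2 * seriesOf X = x + x⁻¹ ∧
      (x - x⁻¹) * seriesOf (polyR b) = 2 * seriesOf (C ε) * f := by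
    set u := f / seriesOf (polyR b) with hu
    have huR : u * seriesOf (polyR b) = f := div_mul_cancel₀ f hR0
    have hu2 : u ^ 2 = seriesOf X ^ 2 - 1 := by
      rw [hu, div_pow, hf, polyD_eq, map_mul, map_pow,
        mul_div_cancel_right₀ _ (pow_ne_zero _ hR0), map_sub, map_pow, map_one]
    have hprod : (seriesOf X + u) * (seriesOf X - u) = 1 := by linear_combination -hu2
    have hp0 := left_ne_zero_of_mul_eq_one hprod
    have hm0 := right_ne_zero_of_mul_eq_one hprod
    have hord : (seriesOf X + u).order + (seriesOf X - u).order = 0 := by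
      rw [← HahnSeries.order_mul hp0 hm0, hprod, HahnSeries.order_one]
    have hpi : (seriesOf X + u)⁻¹ = seriesOf X - u := inv_eq_of_mul_eq_one_right hprod
    have hmi : (seriesOf X - u)⁻¹ = seriesOf X + u := inv_eq_of_mul_eq_one_left hprod
    have huo : u.order = -1 := by
      have hu0 : u ≠ 0 := by rintro h; rw [h, zero_mul] at huR; exact hf0 huR.symm
      have := congrArg HahnSeries.order huR
      rw [HahnSeries.order_mul hu0 hR0, order_seriesOf, natDegree_polyR, hfo] at this
      omega
    have hXo : (seriesOf X).order = -1 := by rw [order_seriesOf, natDegree_X]; rfl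
    have hpl : -1 ≤ (seriesOf X + u).order := by
      have := HahnSeries.min_order_le_order_add hp0
      rwa [huo, hXo, min_self] at this
    have hml : -1 ≤ (seriesOf X - u).order := by
      have hm0' : seriesOf X + -u ≠ 0 := by rwa [← sub_eq_add_neg]
      have := HahnSeries.min_order_le_order_add hm0'
      rwa [HahnSeries.order_neg, huo, hXo, min_self, ← sub_eq_add_neg] at this
    have hs0 : (seriesOf X + u) + (seriesOf X - u) ≠ 0 := by
      have : (seriesOf X + u) + (seriesOf X - u) = seriesOf (C 2 * X) := by
        rw [map_mul, show (C 2 : ℂ[X]) = 2 from rfl, map_ofNat]; ring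
      rw [this]
      exact seriesOf_ne_zero (mul_ne_zero (C_ne_zero.mpr two_ne_zero) X_ne_zero)
    -- The two mutually inverse series t ± u add up to 2t, so one of them has a pole. That one is
    -- taken as x, and ε records the sign.
    have hso : min (seriesOf X + u).order (seriesOf X - u).order ≤ -1 := by
      have := HahnSeries.min_order_le_order_add hs0
      rw [show (seriesOf X + u) + (seriesOf X - u) = seriesOf (C 2 * X) by
        rw [map_mul, show (C 2 : ℂ[X]) = 2 from rfl, map_ofNat]; ring, order_seriesOf,
        natDegree_C_mul_X _ two_ne_zero] at this
      exact_mod_cast this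
    rcases min_le_iff.mp hso with h | h
    · refine ⟨seriesOf X + u, 1, one_pow 2, le_antisymm h hpl, hp0, ?_, ?_⟩
      · rw [hpi]; ring
      · rw [hpi, C_1, map_one]; linear_combination 2 * huR
    · refine ⟨seriesOf X - u, -1, by norm_num, le_antisymm h hml, hm0, ?_, ?_⟩
      · rw [hmi]; ring
      · rw [hmi, C_neg, C_1, map_neg, map_one]; linear_combination -2 * huR
  -- the approximation `p / q`
  have hbt : ∀ i, (antisymmPart A n).eval (rho b i) = 0 := by
    intro i
    have hbi := (b i).ne_zero
    have h := sub_inv_mul_aeval_antisymmPart hbi (two_mul_rho i) A n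
    have h0 : (b i : ℂ) ^ (n : ℤ) * aeval (b i : ℂ)⁻¹ A - (b i : ℂ) ^ (-(n : ℤ)) * aeval (b i : ℂ) A
        = 0 := by
      rw [coe_aeval_eq_eval, coe_aeval_eq_eval, ← hA i, zpow_neg, zpow_natCast]
      field_simp
      ring
    rw [h0, coe_aeval_eq_eval] at h
    exact (mul_eq_zero.mp h).resolve_left (sub_ne_zero.mpr (hb.ne_inv i i))
  obtain ⟨q, hq⟩ := polyR_dvd hb hbt
  set p := symmPart A n with hp
  have hP := two_mul_aeval_symmPart hx0 hsum A n
  have hQ := sub_inv_mul_aeval_antisymmPart hx0 hsum A n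
  rw [← seriesOf_eq_aeval, ← hp] at hP
  rw [← seriesOf_eq_aeval, hq, map_mul, ← mul_assoc, hdiff] at hQ
  have hxi : x⁻¹.order = 1 := by
    have h := congrArg HahnSeries.order (mul_inv_cancel₀ hx0)
    rw [HahnSeries.order_mul hx0 (inv_ne_zero hx0), HahnSeries.order_one] at h
    omega
  obtain ⟨ha1, ha2⟩ := aeval_of_order_one hxi hA0
  obtain ⟨hc1, hc2⟩ := aeval_of_order_neg_one hx hAne
  have hxz : x ^ (-(n : ℤ)) = x⁻¹ ^ n := by rw [zpow_neg, zpow_natCast, inv_pow]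
  have hbig : (x ^ (n : ℤ) * aeval x⁻¹ A).order = -(n : ℤ) := by
    rw [zpow_natCast, HahnSeries.order_mul (pow_ne_zero _ hx0) ha1, HahnSeries.order_pow, hx, ha2]
    simp
  have hsmall : (x ^ (-(n : ℤ)) * aeval x A).order = (n : ℤ) - A.natDegree := by
    rw [hxz, HahnSeries.order_mul (pow_ne_zero _ (inv_ne_zero hx0)) hc1, HahnSeries.order_pow,
      hxi, hc2]
    simp; ring
  have hbig0 : x ^ (n : ℤ) * aeval x⁻¹ A ≠ 0 := mul_ne_zero (zpow_ne_zero _ hx0) ha1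
  have hsmall0 : x ^ (-(n : ℤ)) * aeval x A ≠ 0 := mul_ne_zero (zpow_ne_zero _ hx0) hc1
  have h2 : (2 : LaurentSeries ℂ) = seriesOf (C 2) := by
    rw [show (C 2 : ℂ[X]) = 2 from rfl, map_ofNat]
  have h2o : (2 : LaurentSeries ℂ).order = 0 := by rw [h2, order_seriesOf, natDegree_C]; rfl
  have h20 : (2 : LaurentSeries ℂ) ≠ 0 := by
    rw [h2]; exact seriesOf_ne_zero (C_ne_zero.mpr two_ne_zero)
  have hdiffo : (x ^ (n : ℤ) * aeval x⁻¹ A - x ^ (-(n : ℤ)) * aeval x A).orderTop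
      = ((-(n : ℤ) : ℤ) : WithTop ℤ) := by
    rw [HahnSeries.orderTop_sub, ← HahnSeries.order_eq_orderTop_of_ne_zero hbig0, hbig]
    rw [← HahnSeries.order_eq_orderTop_of_ne_zero hbig0,
      ← HahnSeries.order_eq_orderTop_of_ne_zero hsmall0, hbig, hsmall, WithTop.coe_lt_coe]
    omega
  have hε0 : ε ≠ 0 := by rintro rfl; norm_num at hε
  have hqf : 2 * (seriesOf (C ε * q) * f)
      = x ^ (n : ℤ) * aeval x⁻¹ A - x ^ (-(n : ℤ)) * aeval x A := by
    rw [map_mul, ← hQ]; ring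
  have hqf0 : 2 * (seriesOf (C ε * q) * f) ≠ 0 := by
    rw [← HahnSeries.orderTop_ne_top, hqf, hdiffo]
    exact WithTop.coe_ne_top
  have hq0 : C ε * q ≠ 0 := by
    intro h
    rw [h, map_zero, zero_mul, mul_zero] at hqf0
    exact hqf0 rfl
  have hqdeg : ((C ε * q).natDegree : ℤ) + (g + 1) = n := by
    have h : (2 * (seriesOf (C ε * q) * f)).order = -(n : ℤ) := by
      rw [← hqf, ← HahnSeries.order_eq_orderTop_of_ne_zero hqf0] at hdiffo
      exact_mod_cast hdiffo
    rw [HahnSeries.order_mul h20 (right_ne_zero_of_mul hqf0),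
      HahnSeries.order_mul (seriesOf_ne_zero hq0) hf0, h2o, hfo, order_seriesOf] at h
    omega
  -- Subtracting the antisymmetric identity from the symmetric one cancels the large term xⁿA(x⁻¹).
  have herr : 2 * (seriesOf p - seriesOf (C ε * q) * f) = 2 * (x ^ (-(n : ℤ)) * aeval x A) := by
    linear_combination hP - hqf
  have herr' := mul_left_cancel₀ h20 herr
  -- A common zero t = (s + s⁻¹)/2 would give A(s) = A(s⁻¹) = 0.
  have hcoprime : IsCoprime p (C ε * q) := by
    rw [Polynomial.isCoprime_iff_aeval_ne_zero_of_isAlgClosed ℂ ℂ]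
    intro t
    by_contra! h
    obtain ⟨hpt, hqt⟩ := h
    obtain ⟨s, hs0, hst⟩ := exists_joukowsky t
    have hqt' : aeval t (antisymmPart A n) = 0 := by
      rw [hq, map_mul]
      rw [map_mul, aeval_C] at hqt
      rw [(mul_eq_zero.mp hqt).resolve_left (by simpa using hε0), mul_zero]
    have e1 := two_mul_aeval_symmPart hs0 hst A n
    have e2 := sub_inv_mul_aeval_antisymmPart hs0 hst A n
    rw [← hp, hpt] at e1
    rw [hqt'] at e2
    have e3 : s ^ (n : ℤ) * aeval s⁻¹ A = 0 := by
      linear_combination -(1 / 2 : ℂ) * e1 - (1 / 2 : ℂ) * e2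
    have e4 : s ^ (-(n : ℤ)) * aeval s A = 0 := by
      linear_combination -(1 / 2 : ℂ) * e1 + (1 / 2 : ℂ) * e2
    have e5 := (mul_eq_zero.mp e3).resolve_left (zpow_ne_zero _ hs0)
    have e6 := (mul_eq_zero.mp e4).resolve_left (zpow_ne_zero _ hs0)
    exact hcop s hs0 e6 e5
  obtain ⟨k, hk1, hk2⟩ := exists_denDeg_of_approx hirr hcoprime hq0
    (by rw [herr', hsmall]; omega)
  rw [herr', hsmall] at hk2
  exact ⟨k, by omega, by omega⟩

/-! ### Polynomials in `t = (s + s⁻¹) / 2` as rational functions of `s` -/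

/-- The polynomial `s ^ deg r * r ((s + s⁻¹) / 2)` in `s`. -/
def homog (r : ℂ[X]) : ℂ[X] :=
  ∑ k ∈ Finset.range (r.natDegree + 1),
    C (r.coeff k) * ((C (1 / 2) * (X ^ 2 + 1)) ^ k * X ^ (r.natDegree - k))

lemma aeval_homog {K : Type*} [Field K] [Algebra ℂ K] {x t : K} (hx : x ≠ 0)
    (ht : 2 * t = x + x⁻¹) (r : ℂ[X]) :
    aeval x (homog r) = x ^ r.natDegree * aeval t r := by
  have h2 : (algebraMap ℂ K) (1 / 2) * 2 = 1 := by
    rw [← map_ofNat (algebraMap ℂ K) 2, ← map_mul]; norm_num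
  have h : (algebraMap ℂ K) (1 / 2) * (x ^ 2 + 1) = x * t := by
    have h3 : x * (x + x⁻¹) = x ^ 2 + 1 := by field_simp
    rw [← h3, ← ht]
    linear_combination x * t * h2
  rw [aeval_eq_sum_range (p := r), homog, map_sum, Finset.mul_sum]
  refine Finset.sum_congr rfl fun k hk => ?_
  have hk' : k ≤ r.natDegree := Nat.lt_succ_iff.mp (Finset.mem_range.mp hk)
  simp only [map_mul, map_pow, aeval_C, map_add, aeval_X, map_one]
  rw [h, Algebra.smul_def, mul_pow]
  have : x ^ r.natDegree = x ^ k * x ^ (r.natDegree - k) := by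
    rw [← pow_add, Nat.add_sub_cancel' hk']
  rw [this]; ring

lemma eval_homog {s t : ℂ} (hs : s ≠ 0) (ht : 2 * t = s + s⁻¹) (r : ℂ[X]) :
    (homog r).eval s = s ^ r.natDegree * r.eval t := by
  simpa [coe_aeval_eq_eval] using aeval_homog hs ht r

/-- If some `bᵢ` is not a root of unity, then `D` is not Pellian. -/
theorem not_isPellian_of_not_isOfFinOrder {g : ℕ} {b : Fin g → ℂˣ} {i : Fin g}
    (hi : ¬ IsOfFinOrder (b i)) : ¬ IsPellian (polyD b) := by
  rintro ⟨x, y, -, hy, hxy⟩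
  set z := y * polyR b with hz
  have hxz : x ^ 2 - (X ^ 2 - 1) * z ^ 2 = 1 := by
    rw [polyD_eq] at hxy
    rw [hz]; linear_combination hxy
  have hpell : ∀ t : ℂ, x.eval t ^ 2 - (t ^ 2 - 1) * z.eval t ^ 2 = 1 := fun t => by
    simpa using congrArg (eval t) hxz
  set N := x.natDegree + z.natDegree + 1 with hN
  -- P and Q are s^N(x + uz) and s^N(x - uz), with denominators cleared.
  set P := homog x * X ^ (z.natDegree + 1) + C (1 / 2) * (X ^ 2 - 1) * homog z * X ^ x.natDegree
    with hP
  set Q := homog x * X ^ (z.natDegree + 1) - C (1 / 2) * (X ^ 2 - 1) * homog z * X ^ x.natDegree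
    with hQ
  have hPe : ∀ s t : ℂ, s ≠ 0 → 2 * t = s + s⁻¹ →
      P.eval s = s ^ N * (x.eval t + (s - s⁻¹) / 2 * z.eval t) := by
    intro s t hs ht
    simp only [hP, hN, eval_add, eval_mul, eval_pow, eval_X, eval_C, eval_sub, eval_one,
      eval_homog hs ht, pow_add]
    field_simp
  have hQe : ∀ s t : ℂ, s ≠ 0 → 2 * t = s + s⁻¹ →
      Q.eval s = s ^ N * (x.eval t - (s - s⁻¹) / 2 * z.eval t) := by
    intro s t hs ht
    simp only [hQ, hN, eval_mul, eval_pow, eval_X, eval_C, eval_sub, eval_one,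
      eval_homog hs ht, pow_add]
    field_simp
  have hsq : ∀ s t : ℂ, s ≠ 0 → 2 * t = s + s⁻¹ → ((s - s⁻¹) / 2) ^ 2 = t ^ 2 - 1 := by
    intro s t hs ht
    have h1 : s * s⁻¹ = 1 := mul_inv_cancel₀ hs
    have h2 : t = (s + s⁻¹) / 2 := by rw [← ht]; ring
    rw [h2]
    linear_combination -h1
  -- The extra factor X makes both sides vanish at s = 0, where the evaluation formulas do not
  -- apply.
  have hPQ : P * Q * X = X ^ (2 * N + 1) := by
    refine Polynomial.funext fun s => ?_
    by_cases hs : s = 0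
    · simp [hs]
    have ht : 2 * ((s + s⁻¹) / 2) = s + s⁻¹ := by ring
    have h1 := hpell ((s + s⁻¹) / 2)
    have h2 := hsq s _ hs ht
    simp only [eval_mul, eval_pow, eval_X]
    rw [hPe s _ hs ht, hQe s _ hs ht]
    linear_combination s ^ (2 * N + 1) * h1 - s ^ (2 * N + 1) * z.eval ((s + s⁻¹) / 2) ^ 2 * h2
  obtain ⟨k, -, u, hu⟩ := (dvd_prime_pow prime_X _).mp
    (Dvd.intro (Q * X) (by rw [← hPQ]; ring) : P ∣ X ^ (2 * N + 1))
  obtain ⟨c, hc, huc⟩ := Polynomial.isUnit_iff.mp u.isUnit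
  have hc0 : c ≠ 0 := hc.ne_zero
  have hPc : ∀ s, P.eval s * c = s ^ k := fun s => by
    have := congrArg (eval s) hu
    rw [← huc] at this
    simpa using this
  -- Now c(x + uz) = s^(k-N). As z vanishes at ρᵢ, the values at bᵢ and bᵢ⁻¹ coincide, so bᵢ^(2N) =
  -- bᵢ^(2k).
  have hkN : k = N := by
    have hb0 := (b i).ne_zero
    have ht := two_mul_rho (b := b) i
    have ht' : 2 * rho b i = (b i : ℂ)⁻¹ + (b i : ℂ)⁻¹⁻¹ := by rw [ht, inv_inv, add_comm]
    have hz0 : z.eval (rho b i) = 0 := by rw [hz, eval_mul, polyR_eval_rho, mul_zero]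
    have e1 := hPc (b i)
    have e2 := hPc (b i : ℂ)⁻¹
    rw [hPe _ _ hb0 ht, hz0, mul_zero, add_zero] at e1
    rw [hPe _ _ (inv_ne_zero hb0) ht', hz0, mul_zero, add_zero] at e2
    have hx0 : x.eval (rho b i) ≠ 0 := by
      intro h0
      have := hpell (rho b i)
      rw [h0, hz0] at this
      norm_num at this
    have e3 : (b i : ℂ) ^ (2 * N) = (b i : ℂ) ^ (2 * k) := by
      have h4 : (b i : ℂ) ^ k * (x.eval (rho b i) * c) = (b i : ℂ) ^ N := by
        rw [inv_pow, inv_pow] at e2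
        field_simp at e2
        linear_combination e2
      apply mul_right_cancel₀ (mul_ne_zero hx0 hc0)
      rw [two_mul, two_mul, pow_add, pow_add]
      linear_combination (b i : ℂ) ^ N * e1 - (b i : ℂ) ^ k * h4
    have e4 : b i ^ (2 * N) = b i ^ (2 * k) := Units.ext (by push_cast; exact e3)
    have := injective_pow_iff_not_isOfFinOrder.mpr hi e4
    omega
  -- Since x + uz is constant, replacing s by s⁻¹ gives uz = 0; one more factor u makes this a
  -- polynomial identity in t.
  have hz0 : (X ^ 2 - 1) * z = 0 := by
    refine Polynomial.funext fun t => ?_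
    obtain ⟨s, hs, ht⟩ := exists_joukowsky t
    have ht' : 2 * t = s⁻¹ + s⁻¹⁻¹ := by rw [ht, inv_inv, add_comm]
    have e1 := hPc s
    have e2 := hPc s⁻¹
    rw [hPe _ _ hs ht, hkN] at e1
    rw [hPe _ _ (inv_ne_zero hs) ht', hkN, inv_inv] at e2
    have e1' : (x.eval t + (s - s⁻¹) / 2 * z.eval t) * c = 1 := by
      apply mul_left_cancel₀ (pow_ne_zero N hs); linear_combination e1
    have e2' : (x.eval t + (s⁻¹ - s) / 2 * z.eval t) * c = 1 := by
      apply mul_left_cancel₀ (pow_ne_zero N (inv_ne_zero hs)); linear_combination e2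
    have e3 : (s - s⁻¹) / 2 * z.eval t = 0 := by
      apply mul_right_cancel₀ hc0; linear_combination (1 / 2 : ℂ) * e1' - (1 / 2 : ℂ) * e2'
    simp only [eval_mul, eval_sub, eval_pow, eval_X, eval_one, eval_zero]
    rw [← hsq s t hs ht, sq, mul_assoc, e3, mul_zero]
  exact mul_ne_zero X_sq_sub_one_ne_zero (mul_ne_zero hy polyR_monic.ne_zero) hz0

/-! ### Divisors of rational functions -/

/-- The divisor of a polynomial. -/
def polyDiv (p : ℂ[X]) : OnePoint ℂ →₀ ℤ :=
  (p.roots.map fun a : ℂ => Finsupp.single (a : OnePoint ℂ) 1 - Finsupp.single OnePoint.infty 1).sum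

lemma polyDiv_infty (p : ℂ[X]) : polyDiv p OnePoint.infty = -(p.natDegree : ℤ) := by
  have h : ∀ s : Multiset ℂ, ((s.map fun a : ℂ => (Finsupp.single (a : OnePoint ℂ) (1 : ℤ)
      - Finsupp.single OnePoint.infty 1 : OnePoint ℂ →₀ ℤ)).sum : OnePoint ℂ →₀ ℤ) OnePoint.infty = -(s.card : ℤ) := fun s => by
    induction s using Multiset.induction_on with
    | empty => simp
    | cons a s ih =>
      rw [Multiset.map_cons, Multiset.sum_cons, Finsupp.add_apply, ih]
      simp
  rw [polyDiv, h, (splits_iff_card_roots.mp (IsAlgClosed.splits p))]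

lemma polyDiv_coe (p : ℂ[X]) (a : ℂ) : polyDiv p (a : OnePoint ℂ) = p.rootMultiplicity a := by
  classical
  have h : ∀ s : Multiset ℂ, ((s.map fun a : ℂ => (Finsupp.single (a : OnePoint ℂ) (1 : ℤ)
      - Finsupp.single OnePoint.infty 1 : OnePoint ℂ →₀ ℤ)).sum : OnePoint ℂ →₀ ℤ) (a : OnePoint ℂ) = (s.count a : ℤ) := fun s => by
    induction s using Multiset.induction_on with
    | empty => simp
    | cons c s ih =>
      rw [Multiset.map_cons, Multiset.sum_cons, Finsupp.add_apply, ih, Multiset.count_cons,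
        Finsupp.sub_apply, Finsupp.single_apply, Finsupp.single_apply, OnePoint.coe_eq_coe,
        if_neg (OnePoint.infty_ne_coe a)]
      push_cast
      simp only [eq_comm (a := c)]
      ring
  rw [polyDiv, h, count_roots]

/-- The degree of a divisor. -/
def divDegree : (OnePoint ℂ →₀ ℤ) →+ ℤ :=
  Finsupp.liftAddHom fun _ => AddMonoidHom.id ℤ

lemma divDegree_apply (E : OnePoint ℂ →₀ ℤ) : divDegree E = E.sum fun _ n => n := rfl

lemma divDegree_polyDiv (p : ℂ[X]) : divDegree (polyDiv p) = 0 := by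
  rw [polyDiv, map_multiset_sum, Multiset.map_map]
  refine Multiset.sum_eq_zero fun x hx => ?_
  obtain ⟨a, -, rfl⟩ := Multiset.mem_map.mp hx
  rw [Function.comp_apply, map_sub]
  simp [divDegree]

lemma isDivisorOf_num_denom {f : RatFunc ℂ} (hf : f ≠ 0) :
    IsDivisorOf (polyDiv f.num - polyDiv f.denom) f := by
  refine ⟨hf, fun P => ?_⟩
  induction P using OnePoint.rec with
  | infty =>
    rw [Finsupp.sub_apply, polyDiv_infty, polyDiv_infty]
    change _ = -f.intDegree
    rw [RatFunc.intDegree]; ring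
  | coe a =>
    rw [Finsupp.sub_apply, polyDiv_coe, polyDiv_coe]
    rfl

lemma ordAt_mul {f h : RatFunc ℂ} (hf : f ≠ 0) (hh : h ≠ 0) (P : OnePoint ℂ) :
    ordAt (f * h) P = ordAt f P + ordAt h P := by
  induction P using OnePoint.rec with
  | infty =>
    change -(f * h).intDegree = -f.intDegree + -h.intDegree
    rw [RatFunc.intDegree_mul hf hh]; ring
  | coe a =>
    change ((f * h).num.rootMultiplicity a : ℤ) - (f * h).denom.rootMultiplicity a
      = (f.num.rootMultiplicity a - f.denom.rootMultiplicity a)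
        + (h.num.rootMultiplicity a - h.denom.rootMultiplicity a)
    have h1 := congrArg (rootMultiplicity a) (RatFunc.num_denom_mul f h)
    have n1 := RatFunc.num_ne_zero hf
    have n2 := RatFunc.num_ne_zero hh
    have n3 := RatFunc.num_ne_zero (mul_ne_zero hf hh)
    have d1 := f.denom_ne_zero
    have d2 := h.denom_ne_zero
    have d3 := (f * h).denom_ne_zero
    rw [rootMultiplicity_mul (mul_ne_zero n3 (mul_ne_zero d1 d2)),
      rootMultiplicity_mul (mul_ne_zero d1 d2), rootMultiplicity_mul
      (mul_ne_zero (mul_ne_zero n1 n2) d3), rootMultiplicity_mul (mul_ne_zero n1 n2)] at h1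
    omega

lemma IsDivisorOf.of_mul {E E' : OnePoint ℂ →₀ ℤ} {f h : RatFunc ℂ}
    (hE : IsDivisorOf E (f * h)) (hE' : IsDivisorOf E' h) : IsDivisorOf (E - E') f :=
  ⟨left_ne_zero_of_mul hE.1, fun P => by
    rw [Finsupp.sub_apply, hE.2, hE'.2, ordAt_mul (left_ne_zero_of_mul hE.1) hE'.1]; ring⟩

lemma isDivisorOf_algebraMap {p : ℂ[X]} (hp : p ≠ 0) :
    IsDivisorOf (polyDiv p) (algebraMap ℂ[X] (RatFunc ℂ) p) := by
  have h := isDivisorOf_num_denom (f := algebraMap ℂ[X] (RatFunc ℂ) p)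
    (RatFunc.algebraMap_ne_zero hp)
  have h1 : polyDiv 1 = 0 := by simp [polyDiv]
  rwa [RatFunc.num_algebraMap, RatFunc.denom_algebraMap, h1, sub_zero] at h

lemma isDivisorOf_div {p q : ℂ[X]} (hp : p ≠ 0) (hq : q ≠ 0) :
    IsDivisorOf (polyDiv p - polyDiv q)
      (algebraMap ℂ[X] (RatFunc ℂ) p / algebraMap ℂ[X] (RatFunc ℂ) q) := by
  refine IsDivisorOf.of_mul ?_ (isDivisorOf_algebraMap hq)
  rw [div_mul_cancel₀ _ (RatFunc.algebraMap_ne_zero hq)]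
  exact isDivisorOf_algebraMap hp

/-- `RatFunc.eval` uses the reduced fraction. Its denominator divides q, so it does not vanish at a
either. -/
lemma eval_algebraMap_div {K : Type} [Field K] (φ : ℂ →+* K) {a : K} (p : ℂ[X]) {q : ℂ[X]}
    (hq : q.eval₂ φ a ≠ 0) :
    RatFunc.eval φ a (algebraMap ℂ[X] (RatFunc ℂ) p / algebraMap ℂ[X] (RatFunc ℂ) q)
      = p.eval₂ φ a / q.eval₂ φ a := by
  have hq0 : q ≠ 0 := by rintro rfl; simp at hq
  set f := algebraMap ℂ[X] (RatFunc ℂ) p / algebraMap ℂ[X] (RatFunc ℂ) q with hf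
  have hd : f.denom.eval₂ φ a ≠ 0 := fun h =>
    hq (eval₂_eq_zero_of_dvd_of_eval₂_eq_zero φ a (RatFunc.denom_div_dvd p q) h)
  have h := congrArg (eval₂ φ a) ((RatFunc.num_mul_eq_mul_denom_iff hq0).mpr hf)
  rw [eval₂_mul, eval₂_mul] at h
  rw [RatFunc.eval, div_eq_div_iff hd hq, h]

/-! ### Membership in `W_l` -/

/-- Used to pad the roots of A to exactly l points by copies of ∞₊, whose class is zero. -/
lemma exists_fin_sum_eq {α M : Type*} [AddCommMonoid M] (φ : α → M) {x₀ : α} (h₀ : φ x₀ = 0)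
    (l : ℕ) (s : Multiset α) (hs : s.card ≤ l) :
    ∃ P : Fin l → α, (∀ j, P j ∈ s ∨ P j = x₀) ∧ ∑ j, φ (P j) = (s.map φ).sum := by
  induction l generalizing s with
  | zero =>
    obtain rfl := Multiset.card_eq_zero.mp (Nat.le_zero.mp hs)
    exact ⟨Fin.elim0, fun j => j.elim0, by simp⟩
  | succ l ih =>
    induction s using Multiset.induction_on with
    | empty => exact ⟨fun _ => x₀, fun _ => Or.inr rfl, by simp [h₀]⟩
    | cons a s _ =>
      rw [Multiset.card_cons] at hs
      obtain ⟨P, hP, hsum⟩ := ih s (by omega)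
      refine ⟨Fin.cons a P, fun j => ?_, ?_⟩
      · induction j using Fin.cases with
        | zero => simp
        | succ j =>
          rw [Fin.cons_succ]
          exact (hP j).imp_left (Multiset.mem_cons_of_mem ·)
      · rw [Fin.sum_univ_succ, Multiset.map_cons, Multiset.sum_cons]
        simp [hsum]

variable {g : ℕ} {b : Fin g → ℂˣ}

variable (b) in
/-- The projection from divisors to `G`. -/
def toGroupG : divZero b →+ GroupG b :=
  (QuotientAddGroup.mk' (invariantPart b)).comp (QuotientAddGroup.mk' (mTrivial b))

lemma toGroupG_eq_zero {E E' : divZero b} {f h : RatFunc ℂ}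
    (hE : IsDivisorOf (E : OnePoint ℂ →₀ ℤ) (f * h)) (hf : IsOneOnSupport b f)
    (hE' : IsDivisorOf (E' : OnePoint ℂ →₀ ℤ) h) (hh : IsGaloisInvariant h) :
    toGroupG b E = 0 := by
  have h1 : toGroupG b (E - E') = 0 := by
    have : (QuotientAddGroup.mk' (mTrivial b)) (E - E') = 0 :=
      (QuotientAddGroup.eq_zero_iff _).mpr (AddSubgroup.subset_closure ⟨f, hE.of_mul hE', hf⟩)
    rw [toGroupG, AddMonoidHom.comp_apply, this, map_zero]
  have h2 : toGroupG b E' = 0 :=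
    (QuotientAddGroup.eq_zero_iff _).mpr (AddSubgroup.subset_closure ⟨E', h, hE', hh, rfl⟩)
  rw [← sub_add_cancel E E', map_add, h1, h2]
  exact add_zero (0 : GroupG b)

lemma isGaloisInvariant_homog (r : ℂ[X]) :
    IsGaloisInvariant (algebraMap ℂ[X] (RatFunc ℂ) (homog r)
      / algebraMap ℂ[X] (RatFunc ℂ) (X ^ r.natDegree)) := by
  have hX : (RatFunc.X : RatFunc ℂ) ≠ 0 := RatFunc.X_ne_zero
  set t : RatFunc ℂ := (RatFunc.X + RatFunc.X⁻¹) / 2 with ht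
  have h2 : (2 : RatFunc ℂ) ≠ 0 := two_ne_zero
  have ht1 : 2 * t = RatFunc.X + RatFunc.X⁻¹ := by rw [ht]; field_simp
  have ht2 : 2 * t = RatFunc.X⁻¹ + RatFunc.X⁻¹⁻¹ := by rw [ht1, inv_inv, add_comm]
  have e1 := aeval_homog hX ht1 r
  have e2 := aeval_homog (inv_ne_zero hX) ht2 r
  have e3 : algebraMap ℂ[X] (RatFunc ℂ) (homog r) = aeval RatFunc.X (homog r) := by
    rw [RatFunc.aeval_X_left_eq_algebraMap]
  have e4 : (homog r).eval₂ RatFunc.C RatFunc.X⁻¹ = aeval RatFunc.X⁻¹ (homog r) := by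
    rw [aeval_def, RatFunc.algebraMap_eq_C]
  rw [IsGaloisInvariant, eval_algebraMap_div, e4, e2, e3, e1, eval₂_pow, eval₂_X, map_pow,
    RatFunc.algebraMap_X, mul_div_cancel_left₀ _ (pow_ne_zero _ (inv_ne_zero hX)),
    mul_div_cancel_left₀ _ (pow_ne_zero _ hX)]
  rw [eval₂_pow, eval₂_X]
  exact pow_ne_zero _ (inv_ne_zero hX)

/-- A polynomial `A` of degree at most `l` with `bᵢⁿ A(bᵢ⁻¹) = bᵢ⁻ⁿ A(bᵢ) ≠ 0` for all `i`
witnesses that `nδ ∈ W_l`. -/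
theorem nsmul_delta_mem_setW (hb : IsAdmissible b) (hg : 0 < g) {A : ℂ[X]} {n l : ℕ}
    (hl : A.natDegree ≤ l) (hA0 : ∀ i, A.eval (b i : ℂ) ≠ 0)
    (hA : ∀ i, (b i : ℂ) ^ (2 * n) * A.eval (b i : ℂ)⁻¹ = A.eval (b i : ℂ)) :
    n • delta b ∈ setW b l := by
  have hbn : ∀ i, (b i : ℂ) ≠ 0 := fun i => (b i).ne_zero
  have hA0' : ∀ i, A.eval (b i : ℂ)⁻¹ ≠ 0 := fun i h => hA0 i (by rw [← hA i, h, mul_zero])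
  have hAne : A ≠ 0 := by rintro rfl; exact hA0 ⟨0, hg⟩ (by simp)
  -- the points
  obtain ⟨P, hP, hPsum⟩ := exists_fin_sum_eq
    (fun P : OnePoint ℂ => (Finsupp.single P 1 - Finsupp.single OnePoint.infty 1 : OnePoint ℂ →₀ ℤ))
    (x₀ := OnePoint.infty) (sub_self _) l (A.roots.map (↑)) (by
      rw [Multiset.card_map]; exact (card_roots' A).trans hl)
  have hPS : ∀ j, P j ∉ modulusSupport b := by
    intro j hj
    rcases hP j with h | h
    · obtain ⟨a, ha, hPa⟩ := Multiset.mem_map.mp h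
      have ha0 : A.eval a = 0 := (mem_roots hAne).mp ha
      rw [← hPa] at hj
      obtain ⟨i, hi | hi⟩ := hj
      · rw [OnePoint.coe_eq_coe] at hi
        exact hA0 i (hi ▸ ha0)
      · rw [OnePoint.coe_eq_coe, Units.val_inv_eq_inv_val] at hi
        exact hA0' i (hi ▸ ha0)
    · exact infty_not_mem_modulusSupport b (h ▸ hj)
  refine ⟨fun j => ⟨P j, hPS j⟩, ?_⟩
  -- the function in `ℂ(t)`
  set r := Lagrange.interpolate Finset.univ (rho b) fun i => A.eval (b i : ℂ) / (b i : ℂ) ^ n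
    with hr
  have hrv : ∀ i, r.eval (rho b i) = A.eval (b i : ℂ) / (b i : ℂ) ^ n := fun i =>
    Lagrange.eval_interpolate_at_node _ hb.rho_injective.injOn (Finset.mem_univ i)
  have hr0 : ∀ i, r.eval (rho b i) ≠ 0 := fun i => by
    rw [hrv]; exact div_ne_zero (hA0 i) (pow_ne_zero _ (hbn i))
  have hh1 : ∀ i, (homog r).eval (b i : ℂ) = (b i : ℂ) ^ r.natDegree * r.eval (rho b i) :=
    fun i => eval_homog (hbn i) (two_mul_rho i) r
  have hh2 : ∀ i, (homog r).eval (b i : ℂ)⁻¹ = (b i : ℂ)⁻¹ ^ r.natDegree * r.eval (rho b i) :=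
    fun i => eval_homog (inv_ne_zero (hbn i)) (by rw [two_mul_rho, inv_inv, add_comm]) r
  have hh1' : ∀ i, (homog r).eval (b i : ℂ) ≠ 0 := fun i => by
    rw [hh1]; exact mul_ne_zero (pow_ne_zero _ (hbn i)) (hr0 i)
  have hh2' : ∀ i, (homog r).eval (b i : ℂ)⁻¹ ≠ 0 := fun i => by
    rw [hh2]; exact mul_ne_zero (pow_ne_zero _ (inv_ne_zero (hbn i))) (hr0 i)
  have hhne : homog r ≠ 0 := fun h => hh1' ⟨0, hg⟩ (by rw [h, eval_zero])
  have hXn : ∀ k, (X ^ k : ℂ[X]) ≠ 0 := fun k => pow_ne_zero _ X_ne_zero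
  have hdiv2 := isDivisorOf_div hhne (hXn r.natDegree)
  have hE2 : polyDiv (homog r) - polyDiv (X ^ r.natDegree) ∈ divZero b := by
    have key : ∀ a : ℂ, a ≠ 0 → (homog r).eval a ≠ 0 →
        (polyDiv (homog r) - polyDiv (X ^ r.natDegree)) (a : OnePoint ℂ) = 0 := by
      intro a ha h1
      rw [Finsupp.sub_apply, polyDiv_coe, polyDiv_coe, rootMultiplicity_eq_zero h1,
        rootMultiplicity_eq_zero (by simp [ha])]
      rfl
    refine ⟨?_, ?_⟩
    · rw [← divDegree_apply, map_sub, divDegree_polyDiv, divDegree_polyDiv, sub_zero]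
    · rintro Q ⟨i, rfl | rfl⟩
      · exact key _ (hbn i) (hh1' i)
      · rw [Units.val_inv_eq_inv_val]
        exact key _ (inv_ne_zero (hbn i)) (hh2' i)
  -- the function that is `1` on the support of the modulus
  set F : RatFunc ℂ := algebraMap ℂ[X] (RatFunc ℂ) (A * X ^ r.natDegree)
    / algebraMap ℂ[X] (RatFunc ℂ) (X ^ n * homog r) with hF
  -- F is s⁻ⁿA(s) divided by r(t), and r interpolates the common values of s⁻ⁿA(s) at bᵢ and bᵢ⁻¹.
  have hFone : IsOneOnSupport b F := by
    intro i
    have hb1 := hbn i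
    constructor
    · rw [hF, eval_algebraMap_div]
      · simp only [eval₂_id, eval_mul, eval_pow, eval_X, hh1, hrv]
        have := hA0 i
        field_simp
      · simp only [eval₂_id, eval_mul, eval_pow, eval_X]
        exact mul_ne_zero (pow_ne_zero _ hb1) (hh1' i)
    · rw [Units.val_inv_eq_inv_val, hF, eval_algebraMap_div]
      · simp only [eval₂_id, eval_mul, eval_pow, eval_X, hh2, hrv]
        rw [← hA i]
        have := hA0' i
        rw [two_mul, pow_add, inv_pow, inv_pow]
        generalize A.eval (b i : ℂ)⁻¹ = v at this ⊢
        field_simp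
      · simp only [eval₂_id, eval_mul, eval_pow, eval_X]
        exact mul_ne_zero (pow_ne_zero _ (inv_ne_zero hb1)) (hh2' i)
  set E : divZero b := ∑ j, pointDivisor b ⟨P j, hPS j⟩
    - n • pointDivisor b ⟨((0 : ℂ) : OnePoint ℂ), zero_not_mem_modulusSupport b⟩ with hE
  have hEcoe : (E : OnePoint ℂ →₀ ℤ) = polyDiv A - polyDiv (X ^ n) := by
    have e1 : polyDiv (X ^ n) = n • (Finsupp.single ((0 : ℂ) : OnePoint ℂ) 1
        - Finsupp.single OnePoint.infty 1) := by
      rw [polyDiv, roots_X_pow, Multiset.map_nsmul, Multiset.sum_nsmul]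
      simp
    have e2 : polyDiv A = ∑ j, (Finsupp.single (P j) 1 - Finsupp.single OnePoint.infty 1) := by
      rw [hPsum, Multiset.map_map]; rfl
    rw [e1, e2, hE]
    simp [pointDivisor]
  have hEdiv : IsDivisorOf (E : OnePoint ℂ →₀ ℤ) (F * (algebraMap ℂ[X] (RatFunc ℂ) (homog r)
      / algebraMap ℂ[X] (RatFunc ℂ) (X ^ r.natDegree))) := by
    rw [hEcoe]
    convert isDivisorOf_div hAne (hXn n) using 1
    have h1 := RatFunc.algebraMap_ne_zero hhne
    have h2 := RatFunc.algebraMap_ne_zero (hXn r.natDegree)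
    have h3 := RatFunc.algebraMap_ne_zero (hXn n)
    rw [hF, map_mul, map_mul]
    field_simp
  have hzero := toGroupG_eq_zero (E' := ⟨_, hE2⟩) hEdiv hFone hdiv2 (isGaloisInvariant_homog r)
  rw [hE, map_sub, map_sum, map_nsmul, sub_eq_zero] at hzero
  exact hzero

/-! ### Witnesses for `nδ ∈ W_l` -/

/-- `A` is a polynomial of degree `l`, prime to `s ^ l * A(s⁻¹)` and to `s`, with
`bᵢⁿ A(bᵢ⁻¹) = bᵢ⁻ⁿ A(bᵢ)` for all `i`. -/
structure IsWitness {g : ℕ} (b : Fin g → ℂˣ) (A : ℂ[X]) (n l : ℕ) : Prop where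
  natDegree_eq : A.natDegree = l
  coeff_zero_ne : A.coeff 0 ≠ 0
  eval_eq : ∀ i, (b i : ℂ) ^ (2 * n) * A.eval (b i : ℂ)⁻¹ = A.eval (b i : ℂ)
  eval_inv_ne : ∀ s, s ≠ 0 → A.eval s = 0 → A.eval s⁻¹ ≠ 0

/-! ### From witnesses to W_l and to partial quotients. -/

section Witness

variable {g : ℕ} {b : Fin g → ℂˣ} {A : ℂ[X]} {n l : ℕ}

lemma IsWitness.nsmul_delta_mem (hA : IsWitness b A n l) (hb : IsAdmissible b) (hg : 0 < g) :
    n • delta b ∈ setW b l := by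
  refine nsmul_delta_mem_setW hb hg hA.natDegree_eq.le (fun i h => ?_) hA.eval_eq
  have h1 := hA.eval_inv_ne _ (b i).ne_zero h
  have h2 := hA.eval_eq i
  rw [h] at h2
  exact mul_ne_zero (pow_ne_zero _ (b i).ne_zero) h1 h2

lemma IsWitness.exists_denDeg (hA : IsWitness b A n l) (hb : IsAdmissible b) (hlg : l ≤ g)
    (hln : l < n) {f : LaurentSeries ℂ} (hf : f ^ 2 = seriesOf (polyD b)) :
    ∃ k, denDeg f k + (g + 1) = n ∧ denDeg f (k + 1) + l = n := by
  obtain rfl := hA.natDegree_eq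
  exact exists_denDeg_of_witness hb hA.coeff_zero_ne hlg hln hA.eval_eq hA.eval_inv_ne hf

/-- A witness for n produces a jump of g + 1 - l starting at denominator degree n - g - 1, so large
n force large indices. -/
lemma infinite_natDegree_partialQuotient (hb : IsAdmissible b) (hlg : l ≤ g)
    (h : ∀ B, ∃ n, B ≤ n ∧ ∃ A, IsWitness b A n l)
    {f : LaurentSeries ℂ} (hf : f ^ 2 = seriesOf (polyD b)) :
    {k | (partialQuotient f k).natDegree + l = g + 1}.Infinite := by
  refine Set.infinite_of_forall_exists_gt fun B => ?_
  obtain ⟨n, hn, A, hA⟩ := h (denDeg f B + g + l + 2)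
  obtain ⟨k, hk1, hk2⟩ := hA.exists_denDeg hb hlg (by omega) hf
  refine ⟨k + 1, ?_, ?_⟩
  · rw [denDeg_succ] at hk2
    change (partialQuotient f (k + 1)).natDegree + l = g + 1
    omega
  · have : denDeg f B < denDeg f k := by omega
    have := (denDeg_strictMono (isIrrational_of_sq_eq_polyD hf)).lt_iff_lt.mp this
    omega

lemma not_isEventuallyPeriodic {i : Fin g} (hi : ¬ IsOfFinOrder (b i))
    {f : LaurentSeries ℂ} (hf : f ^ 2 = seriesOf (polyD b)) :
    ¬ IsEventuallyPeriodic (partialQuotient f) := fun h =>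
  not_isPellian_of_not_isOfFinOrder hi
    (isPellian_of_isEventuallyPeriodic not_isUnit_polyD hf (isIrrational_of_sq_eq_polyD hf) h)

end Witness

lemma pow_ne_one_of_not_isOfFinOrder {h : ℂˣ} (hh : ¬ IsOfFinOrder h) {k : ℕ} (hk : 0 < k) :
    (h : ℂ) ^ k ≠ 1 := fun e =>
  hh (isOfFinOrder_iff_pow_eq_one.mpr ⟨k, hk, Units.ext (by push_cast; exact e)⟩)

/-! ### The first family -/

section FamilyOne

variable {l p q : ℕ} {ω h : ℂˣ}

/-- Raising to the power 2l kills ω and excludes every coincidence involving a nonzero power of h.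
Among powers of ω alone, p < l keeps i + j below 2l, and q ≤ l keeps the exponents 2i distinct
modulo 2l. -/
lemma isAdmissible_familyOne (hp : p + 1 ≤ l) (hq : q ≤ l) (hω : IsPrimitiveRoot ω (2 * l))
    (hh : ¬ IsOfFinOrder h) : IsAdmissible (familyOne p q ω h) := by
  have hl : 0 < 2 * l := by omega
  have hω1 : ω ^ (2 * l) = 1 := hω.pow_eq_one
  have hωk : ∀ k, (ω ^ k) ^ (2 * l) = 1 := fun k => by rw [← pow_mul, mul_comm, pow_mul, hω1, one_pow]
  have hne : ∀ k, 0 < k → h ^ k ≠ 1 := fun k hk e =>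
    hh (isOfFinOrder_iff_pow_eq_one.mpr ⟨k, hk, e⟩)
  have hmix : ∀ a c : ℕ, h * ω ^ a ≠ ω ^ c := fun a c e => by
    have := congrArg (· ^ (2 * l)) e
    simp only [mul_pow, hωk, mul_one] at this
    exact hne _ hl this
  have hmix' : ∀ a c : ℕ, h * ω ^ a ≠ (ω ^ c)⁻¹ := fun a c e => by
    have := congrArg (· ^ (2 * l)) e
    simp only [mul_pow, hωk, mul_one, inv_pow, inv_one] at this
    exact hne _ hl this
  constructor
  · intro i j hij
    ext
    simp only [familyOne] at hij
    split_ifs at hij with h1 h2 h2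
    · have := hω.pow_inj (by omega) (by omega) hij
      omega
    · exact absurd hij.symm (hmix _ _)
    · exact absurd hij (hmix _ _)
    · have h3 := pow_eq_pow_iff_modEq.mp (mul_left_cancel hij)
      rw [← hω.eq_orderOf] at h3
      have h4 := Nat.ModEq.mul_left_cancel' two_ne_zero h3
      have h5 := Nat.modEq_iff_dvd.mp h4
      have h6 := Int.eq_zero_of_abs_lt_dvd h5 (by rw [abs_lt]; push_cast; omega)
      push_cast at h6
      omega
  · intro i j hij
    simp only [familyOne] at hij
    split_ifs at hij with h1 h2 h2
    · rw [eq_inv_iff_mul_eq_one, ← pow_add, hω.pow_eq_one_iff_dvd] at hij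
      have := Nat.le_of_dvd (by omega) hij
      omega
    · exact hmix' (2 * (j + 1)) (i + 1) (by rw [hij, inv_inv])
    · exact hmix' _ _ hij
    · rw [eq_inv_iff_mul_eq_one] at hij
      have := congrArg (· ^ (2 * l)) hij
      simp only [mul_pow, hωk, mul_one, one_pow, ← pow_add] at this
      exact hne _ (by omega) this

/-- The l-th powers of all bᵢ lie in {1, -1, h^l}; hence a polynomial in s^l can satisfy all g
conditions at once. -/
lemma familyOne_pow (hω : IsPrimitiveRoot ω (2 * l)) (k : Fin (p + q)) :
    ((familyOne p q ω h k : ℂ) ^ l) ^ 2 = 1 ∨ (familyOne p q ω h k : ℂ) ^ l = (h : ℂ) ^ l := by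
  have hω1 : (ω : ℂ) ^ (2 * l) = 1 := by
    rw [← Units.val_pow_eq_pow_val, hω.pow_eq_one, Units.val_one]
  rw [familyOne]
  split_ifs
  · left
    push_cast
    rw [← pow_mul, ← pow_mul, show ((k : ℕ) + 1) * (l * 2) = (2 * l) * (k + 1) by ring, pow_mul,
      hω1, one_pow]
  · right
    push_cast
    rw [mul_pow, ← pow_mul, show 2 * ((k : ℕ) + 1) * l = (2 * l) * (k + 1) by ring, pow_mul,
      hω1, one_pow, mul_one]

/-- The polynomials witnessing `nδ ∈ W_l` for the multiples `n` of `l`. -/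
lemma exists_isWitness_familyOne (hl : 0 < l) (hω : IsPrimitiveRoot ω (2 * l))
    (hh : ¬ IsOfFinOrder h) (k : ℕ) (hk : 0 < k) :
    ∃ A, IsWitness (familyOne p q ω h) A ((k + 1) * l) l := by
  set H : ℂ := (h : ℂ) ^ l with hH
  have hH0 : H ≠ 0 := pow_ne_zero _ h.ne_zero
  have hH1 : ∀ j, 0 < j → H ^ j ≠ 1 := fun j hj => by
    rw [hH, ← pow_mul]; exact pow_ne_one_of_not_isOfFinOrder hh (Nat.mul_pos hl hj)
  have hH2 : ∀ j, 0 < j → H ^ j + 1 ≠ 0 := fun j hj e => by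
    have e1 : H ^ j = -1 := by linear_combination e
    refine hH1 (j * 2) (by omega) ?_
    rw [pow_mul, e1]; norm_num
  set α : ℂ := 1 - H ^ (2 * k + 2) with hα
  set β : ℂ := H ^ (2 * k + 1) - H with hβ
  have hα0 : α ≠ 0 := sub_ne_zero.mpr (hH1 _ (by omega)).symm
  have hβ0 : β ≠ 0 := by
    have : β = H * (H ^ (2 * k) - 1) := by rw [hβ]; ring
    rw [this]
    exact mul_ne_zero hH0 (sub_ne_zero.mpr (hH1 _ (by omega)))
  have hsum : α + β ≠ 0 := by
    have : α + β = -((H ^ 1 - 1) * (H ^ (2 * k + 1) + 1)) := by rw [hα, hβ]; ring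
    rw [this]
    exact neg_ne_zero.mpr (mul_ne_zero (sub_ne_zero.mpr (hH1 _ one_pos)) (hH2 _ (by omega)))
  have hdiff : β - α ≠ 0 := by
    have : β - α = (H ^ (2 * k + 1) - 1) * (H ^ 1 + 1) := by rw [hα, hβ]; ring
    rw [this]
    exact mul_ne_zero (sub_ne_zero.mpr (hH1 _ (by omega))) (hH2 _ one_pos)
  have hev : ∀ s, (C α * X ^ l + C β).eval s = α * s ^ l + β := fun s => by simp
  refine ⟨C α * X ^ l + C β, ?_, ?_, fun i => ?_, fun s hs h1 h2 => ?_⟩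
  · rw [natDegree_add_C, natDegree_C_mul_X_pow _ _ hα0]
  · simpa [coeff_X_pow, hl.ne] using hβ0
  · rw [hev, hev, inv_pow, show 2 * ((k + 1) * l) = l * (2 * k + 2) by ring, pow_mul]
    have hB0 : (familyOne p q ω h i : ℂ) ^ l ≠ 0 := pow_ne_zero _ (Units.ne_zero _)
    rcases familyOne_pow (h := h) hω i with hB | hB
    · generalize (familyOne p q ω h i : ℂ) ^ l = B at hB hB0 ⊢
      have h1 : B ^ (2 * k + 2) = 1 := by
        rw [show 2 * k + 2 = 2 * (k + 1) by ring, pow_mul, hB, one_pow]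
      have h2 : B⁻¹ = B := inv_eq_of_mul_eq_one_right (by rw [← sq, hB])
      rw [h1, h2, one_mul]
    · rw [hB, ← hH, hα, hβ]
      field_simp
      ring
  · rw [hev] at h1 h2
    rw [inv_pow] at h2
    have hs' : s ^ l ≠ 0 := pow_ne_zero _ hs
    have h3 : α + β * s ^ l = 0 := by
      field_simp at h2
      linear_combination h2
    have h4 : (α + β) * (β - α) = 0 := by linear_combination β * h1 - α * h3
    exact mul_ne_zero hsum hdiff h4

lemma exists_large_isWitness_familyOne (hl : 0 < l) (hω : IsPrimitiveRoot ω (2 * l))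
    (hh : ¬ IsOfFinOrder h) (B : ℕ) :
    ∃ n, B ≤ n ∧ ∃ A, IsWitness (familyOne p q ω h) A n l :=
  ⟨(B + 1 + 1) * l, by nlinarith, exists_isWitness_familyOne hl hω hh (B + 1) B.succ_pos⟩

lemma exists_not_isOfFinOrder_familyOne (hq : 1 ≤ q) (hω : IsPrimitiveRoot ω (2 * l))
    (hl : 0 < l) (hh : ¬ IsOfFinOrder h) : ∃ i, ¬ IsOfFinOrder (familyOne p q ω h i) := by
  refine ⟨⟨p, by omega⟩, fun hfin => hh ?_⟩
  rw [familyOne, if_neg (by simp)] at hfin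
  have hωf : IsOfFinOrder ω :=
    isOfFinOrder_iff_pow_eq_one.mpr ⟨2 * l, by omega, hω.pow_eq_one⟩
  have := hfin.mul (hωf.pow (n := 2 * (p + 1))).inv
  simpa using this

end FamilyOne

/-! ### The second family -/

section FamilyTwo

variable {θ₁ θ₂ θ₃ h : ℂˣ}

/-- Let E be the monic cubic with roots h, θ₂h, θ₃h, let E'(s) = s³E(s⁻¹) and H = h^(2c+1). For A =
E + HE' and n = c + 2 the condition at b is b^(2c+1)(E' + HE) = E + HE'. It holds at the roots of E,
since b^(2c+1) = H there; at θ₁ it follows from E' = E. -/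
lemma exists_isWitness_familyTwo (hP : IsFamilyTwoParam θ₁ θ₂ θ₃ h) (c : ℕ) (hc : 2 ≤ c)
    (h₁ : θ₁ ^ (2 * c + 1) = 1) (h₂ : θ₂ ^ (2 * c + 1) = 1) (h₃ : θ₃ ^ (2 * c + 1) = 1) :
    ∃ A, IsWitness (familyTwo θ₁ θ₂ θ₃ h) A (c + 2) 3 := by
  have heq := hP.equation
  have hne : ∀ {k}, 0 < k → (h : ℂ) ^ k ≠ 1 := fun hk =>
    pow_ne_one_of_not_isOfFinOrder hP.not_root_of_unity hk
  have hh0 : (h : ℂ) ≠ 0 := h.ne_zero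
  have k₁ : (θ₁ : ℂ) ^ (2 * c + 1) = 1 := by rw [← Units.val_pow_eq_pow_val, h₁, Units.val_one]
  have k₂ : (θ₂ : ℂ) ^ (2 * c + 1) = 1 := by rw [← Units.val_pow_eq_pow_val, h₂, Units.val_one]
  have k₃ : (θ₃ : ℂ) ^ (2 * c + 1) = 1 := by rw [← Units.val_pow_eq_pow_val, h₃, Units.val_one]
  have hinv := hP.admissible.ne_inv
  have b1 : (familyTwo θ₁ θ₂ θ₃ h 1 : ℂ) = h := rfl
  have b2 : (familyTwo θ₁ θ₂ θ₃ h 2 : ℂ) = θ₂ * h := by simp [familyTwo]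
  have b3 : (familyTwo θ₁ θ₂ θ₃ h 3 : ℂ) = θ₃ * h := by simp [familyTwo]
  set H : ℂ := (h : ℂ) ^ (2 * c + 1) with hH
  set E : ℂ → ℂ := fun s => (s - h) * (s - θ₂ * h) * (s - θ₃ * h) with hE
  set E' : ℂ → ℂ := fun s => (1 - h * s) * (1 - θ₂ * h * s) * (1 - θ₃ * h * s) with hE'
  set A : ℂ[X] := C (1 - H * (h ^ 3 * θ₂ * θ₃)) * X ^ 3
    + C (-(h * (1 + θ₂ + θ₃)) + H * (h ^ 2 * (θ₂ + θ₃ + θ₂ * θ₃))) * X ^ 2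
    + C (h ^ 2 * (θ₂ + θ₃ + θ₂ * θ₃) - H * (h * (1 + θ₂ + θ₃))) * X
    + C (-(h ^ 3 * θ₂ * θ₃) + H) with hA
  have hev : ∀ s, A.eval s = E s + H * E' s := fun s => by
    simp only [hA, hE, hE', eval_add, eval_mul, eval_C, eval_pow, eval_X]
    ring
  have hev' : ∀ s, s ≠ 0 → s ^ 3 * A.eval s⁻¹ = E' s + H * E s := fun s hs => by
    rw [hev]
    simp only [hE, hE']
    field_simp
  refine ⟨A, natDegree_cubic ?_, ?_, fun i => ?_, fun s hs e1 e2 => ?_⟩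
  · intro e
    refine hne (k := (2 * c + 4) * (2 * c + 1)) (by positivity) ?_
    have e2 : (h : ℂ) ^ (2 * c + 4) * θ₂ * θ₃ = 1 := by
      rw [hH] at e
      linear_combination -e
    have e3 := congrArg (· ^ (2 * c + 1)) e2
    simp only [mul_pow, k₂, k₃, mul_one, one_pow] at e3
    rw [pow_mul, e3]
  -- A zero constant term would give h^(2c-2) = θ₂θ₃, a root of unity; c ≥ 2 makes the exponent
  -- positive.
  · intro e
    simp only [hA, coeff_add, coeff_C_mul, coeff_X_pow, coeff_X_zero, coeff_C_zero] at e
    norm_num at e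
    refine hne (k := (2 * c - 2) * (2 * c + 1)) (Nat.mul_pos (by omega) (by omega)) ?_
    have e2 : (h : ℂ) ^ (2 * c - 2) = θ₂ * θ₃ := by
      apply mul_left_cancel₀ (pow_ne_zero 3 hh0)
      rw [← pow_add, show 3 + (2 * c - 2) = 2 * c + 1 by omega, ← hH]
      linear_combination e
    rw [pow_mul, e2, mul_pow, k₂, k₃, one_mul]
  · have key : ∀ s : ℂ, s ≠ 0 → s ^ (2 * c + 1) * (E' s + H * E s) = E s + H * E' s →
        s ^ (2 * (c + 2)) * A.eval s⁻¹ = A.eval s := fun s hs e => by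
      rw [hev s, ← e, ← hev' s hs, show 2 * (c + 2) = (2 * c + 1) + 3 by ring, pow_add, mul_assoc]
    refine key _ (Units.ne_zero _) ?_
    fin_cases i
    · change (θ₁ : ℂ) ^ (2 * c + 1) * (E' θ₁ + H * E θ₁) = E θ₁ + H * E' θ₁
      -- E' - E has the trivial zero s = 1; the parameter equation is the vanishing of the remaining
      -- factor at θ₁.
      have : E' θ₁ = E θ₁ := by
        simp only [hE, hE']
        linear_combination (1 - (θ₁ : ℂ)) * heq
      rw [k₁, this]; ring
    · change (h : ℂ) ^ (2 * c + 1) * (E' h + H * E h) = E h + H * E' h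
      have : E h = 0 := by simp only [hE]; ring
      rw [← hH, this]; ring
    · change (familyTwo θ₁ θ₂ θ₃ h 2 : ℂ) ^ (2 * c + 1) * (E' (familyTwo θ₁ θ₂ θ₃ h 2 : ℂ)
        + H * E (familyTwo θ₁ θ₂ θ₃ h 2 : ℂ)) = _
      have : E (θ₂ * h) = 0 := by simp only [hE]; ring
      rw [b2, mul_pow, k₂, one_mul, ← hH]
      change _ = E (familyTwo θ₁ θ₂ θ₃ h 2 : ℂ) + H * E' (familyTwo θ₁ θ₂ θ₃ h 2 : ℂ)
      rw [b2, this]; ring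
    · change (familyTwo θ₁ θ₂ θ₃ h 3 : ℂ) ^ (2 * c + 1) * (E' (familyTwo θ₁ θ₂ θ₃ h 3 : ℂ)
        + H * E (familyTwo θ₁ θ₂ θ₃ h 3 : ℂ)) = _
      have : E (θ₃ * h) = 0 := by simp only [hE]; ring
      rw [b3, mul_pow, k₃, one_mul, ← hH]
      change _ = E (familyTwo θ₁ θ₂ θ₃ h 3 : ℂ) + H * E' (familyTwo θ₁ θ₂ θ₃ h 3 : ℂ)
      rw [b3, this]; ring
  · have f1 := hev s
    have f2 := hev' s hs
    rw [e1] at f1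
    rw [e2, mul_zero] at f2
    have hH2 : 1 - H ^ 2 ≠ 0 := by
      rw [hH, ← pow_mul]
      exact sub_ne_zero.mpr (hne (by omega)).symm
    -- E + HE' = 0 and E' + HE = 0 form a linear system of determinant 1 - H². Its only solution is
    -- E = E' = 0, which would make some bᵢ the inverse of some bⱼ.
    have z1 : E s = 0 := by
      apply (mul_eq_zero.mp (?_ : (1 - H ^ 2) * E s = 0)).resolve_left hH2
      linear_combination -f1 + H * f2
    have z2 : E' s = 0 := by
      rw [z1] at f2; linear_combination -f2
    have g1 : ∃ i, s = familyTwo θ₁ θ₂ θ₃ h i := by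
      simp only [hE, mul_eq_zero, sub_eq_zero] at z1
      rcases z1 with (z | z) | z
      · exact ⟨1, by rw [b1, z]⟩
      · exact ⟨2, by rw [b2, z]⟩
      · exact ⟨3, by rw [b3, z]⟩
    have g2 : ∃ j, s = (familyTwo θ₁ θ₂ θ₃ h j : ℂ)⁻¹ := by
      simp only [hE', mul_eq_zero, sub_eq_zero] at z2
      rcases z2 with (z | z) | z
      · exact ⟨1, by rw [b1]; exact (inv_eq_of_mul_eq_one_right z.symm).symm⟩
      · exact ⟨2, by rw [b2]; exact (inv_eq_of_mul_eq_one_right z.symm).symm⟩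
      · exact ⟨3, by rw [b3]; exact (inv_eq_of_mul_eq_one_right z.symm).symm⟩
    obtain ⟨i, hi⟩ := g1
    obtain ⟨j, hj⟩ := g2
    exact hinv i j (hi ▸ hj)

lemma exists_large_isWitness_familyTwo (hP : IsFamilyTwoParam θ₁ θ₂ θ₃ h) (B : ℕ) :
    ∃ n : ℕ, B ≤ n ∧ ((orderOf θ₁ : ℤ) ∣ 2 * (n : ℤ) - 3 ∧ (orderOf θ₂ : ℤ) ∣ 2 * (n : ℤ) - 3 ∧
      (orderOf θ₃ : ℤ) ∣ 2 * (n : ℤ) - 3) ∧ ∃ A, IsWitness (familyTwo θ₁ θ₂ θ₃ h) A n 3 := by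
  -- An odd common multiple of the orders, large enough for n ≥ B and c ≥ 2, serves as 2c + 1 = 2n -
  -- 3.
  have hodd : Odd (orderOf θ₁ * orderOf θ₂ * orderOf θ₃ * (2 * (B + 2) + 1)) :=
    ((hP.odd₁.mul hP.odd₂).mul hP.odd₃).mul ⟨_, rfl⟩
  obtain ⟨c, hc⟩ := hodd
  have hpos : 0 < orderOf θ₁ * orderOf θ₂ * orderOf θ₃ :=
    ((hP.odd₁.mul hP.odd₂).mul hP.odd₃).pos
  have hBc : B + 2 ≤ c := by nlinarith
  have d1 : orderOf θ₁ ∣ 2 * c + 1 := by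
    rw [← hc]; exact ((dvd_mul_right _ _).mul_right _).mul_right _
  have d2 : orderOf θ₂ ∣ 2 * c + 1 := by
    rw [← hc]; exact ((dvd_mul_left _ _).mul_right _).mul_right _
  have d3 : orderOf θ₃ ∣ 2 * c + 1 := by
    rw [← hc]; exact (dvd_mul_left _ _).mul_right _
  have hcast : 2 * ((c + 2 : ℕ) : ℤ) - 3 = ((2 * c + 1 : ℕ) : ℤ) := by push_cast; ring
  refine ⟨c + 2, by omega, ?_, exists_isWitness_familyTwo hP c (by omega)
    (orderOf_dvd_iff_pow_eq_one.mp d1) (orderOf_dvd_iff_pow_eq_one.mp d2)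
    (orderOf_dvd_iff_pow_eq_one.mp d3)⟩
  rw [hcast]
  exact ⟨Int.natCast_dvd_natCast.mpr d1, Int.natCast_dvd_natCast.mpr d2,
    Int.natCast_dvd_natCast.mpr d3⟩

end FamilyTwo

/-! ### Existence of parameters of the second family -/

lemma exists_rootOfUnity (N : ℕ) (hN : N ≠ 0) : ∃ θ : ℂˣ, orderOf θ = N ∧ ‖(θ : ℂ)‖ = 1 ∧
    (θ : ℂ) + (θ : ℂ)⁻¹ = ((2 * Real.cos (2 * Real.pi / N) : ℝ) : ℂ) := by
  have h := Complex.isPrimitiveRoot_exp N hN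
  refine ⟨Units.mk0 _ (Complex.exp_ne_zero (2 * Real.pi * Complex.I / N)), ?_, ?_, ?_⟩
  · exact (IsPrimitiveRoot.eq_orderOf (IsPrimitiveRoot.coe_units_iff.mp h)).symm
  · exact h.norm'_eq_one hN
  · rw [Units.val_mk0, ← Complex.exp_neg]
    push_cast
    rw [Complex.two_cos]
    congr 2 <;> ring

lemma isAdmissible_familyTwo {θ₁ θ₂ θ₃ h : ℂˣ} (h₁ : ‖(θ₁ : ℂ)‖ = 1) (h₂ : ‖(θ₂ : ℂ)‖ = 1)
    (h₃ : ‖(θ₃ : ℂ)‖ = 1) (hh : 1 < ‖(h : ℂ)‖) (hθ₁ : θ₁ ^ 2 ≠ 1) (hθ₂ : θ₂ ≠ 1) (hθ₃ : θ₃ ≠ 1)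
    (hθ : θ₂ ≠ θ₃) : IsAdmissible (familyTwo θ₁ θ₂ θ₃ h) := by
  have hn : ∀ i, i ≠ 0 → ‖(familyTwo θ₁ θ₂ θ₃ h i : ℂ)‖ = ‖(h : ℂ)‖ := by
    intro i hi
    fin_cases i
    · exact absurd rfl hi
    · rfl
    · simp [familyTwo, h₂]
    · simp [familyTwo, h₃]
  have hn0 : ‖(familyTwo θ₁ θ₂ θ₃ h 0 : ℂ)‖ = 1 := h₁
  have hge : ∀ i, 1 ≤ ‖(familyTwo θ₁ θ₂ θ₃ h i : ℂ)‖ := fun i => by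
    by_cases hi : i = 0
    · rw [hi, hn0]
    · rw [hn i hi]; exact hh.le
  constructor
  · intro i j hij
    by_cases hi : i = 0 <;> by_cases hj : j = 0
    · rw [hi, hj]
    · have := hn j hj
      rw [← hij, hi, hn0] at this
      exact absurd this hh.ne
    · have := hn i hi
      rw [hij, hj, hn0] at this
      exact absurd this hh.ne
    · fin_cases i <;> fin_cases j <;>
        simp [familyTwo, hθ₂, hθ₃, hθ, hθ.symm] at hi hj hij ⊢
  · intro i j hij
    have hprod : ‖(familyTwo θ₁ θ₂ θ₃ h i : ℂ)‖ * ‖(familyTwo θ₁ θ₂ θ₃ h j : ℂ)‖ = 1 := by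
      rw [← norm_mul, hij, ← Units.val_mul, inv_mul_cancel, Units.val_one, norm_one]
    have hi0 := hge i
    have hj0 := hge j
    by_cases hi : i = 0
    · by_cases hj : j = 0
      · rw [hi, hj] at hij
        change θ₁ = θ₁⁻¹ at hij
        exact hθ₁ (by rw [sq]; exact eq_inv_iff_mul_eq_one.mp hij)
      · rw [hn j hj] at hprod; nlinarith
    · rw [hn i hi] at hprod; nlinarith

/-- Take θ₃ = θ₂⁻¹, c = 1 + θ₁ + θ₁⁻¹ and k = 1 + θ₂ + θ₂⁻¹. Divided by θ₁, the equation becomes (η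
+ 1)(c(η² - η + 1) - kη) = 0 for h = η, so η + η⁻¹ = 1 + k/c suffices. As θ₂ has larger order than
θ₁, k > c > 0, and there is a real root η > 1, which is not a root of unity. -/
theorem exists_isFamilyTwoParam (M : ℕ) :
    ∃ θ₁ θ₂ θ₃ h : ℂˣ, IsFamilyTwoParam θ₁ θ₂ θ₃ h ∧ M ≤ orderOf θ₁ := by
  obtain ⟨θ₁, o₁, n₁, c₁⟩ := exists_rootOfUnity (2 * M + 7) (by omega)
  obtain ⟨θ₂, o₂, n₂, c₂⟩ := exists_rootOfUnity (2 * M + 9) (by omega)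
  set φ₁ : ℝ := 2 * Real.pi / (2 * M + 7 : ℕ) with hφ₁
  set φ₂ : ℝ := 2 * Real.pi / (2 * M + 9 : ℕ) with hφ₂
  set c : ℝ := 1 + 2 * Real.cos φ₁ with hc
  set k : ℝ := 1 + 2 * Real.cos φ₂ with hk
  have hpi := Real.pi_pos
  have hM : (0 : ℝ) ≤ M := M.cast_nonneg
  have hlt : φ₂ < φ₁ := by
    rw [hφ₁, hφ₂]; push_cast; gcongr; norm_num
  have hφ₂0 : 0 < φ₂ := by rw [hφ₂]; positivity
  have hφ₁2 : φ₁ < Real.pi / 2 := by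
    rw [hφ₁, div_lt_div_iff₀ (by positivity) two_pos]; push_cast; nlinarith
  have hc0 : 0 < c := by
    have := Real.cos_pos_of_mem_Ioo (x := φ₁) ⟨by linarith, hφ₁2⟩
    rw [hc]; linarith
  have hck : c < k := by
    have := Real.cos_lt_cos_of_nonneg_of_le_pi hφ₂0.le (by linarith) hlt
    rw [hc, hk]; linarith
  set x : ℝ := 1 + k / c with hx
  have hx2 : 2 < x := by
    have := (one_lt_div hc0).mpr hck
    rw [hx]; linarith
  set η : ℝ := (x + √(x ^ 2 - 4)) / 2 with hη
  have hsq : √(x ^ 2 - 4) ^ 2 = x ^ 2 - 4 := Real.sq_sqrt (by nlinarith)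
  have hη1 : 1 < η := by
    have := Real.sqrt_nonneg (x ^ 2 - 4)
    rw [hη]; linarith
  have hηx : η ^ 2 - x * η + 1 = 0 := by
    rw [hη]; linear_combination hsq / 4
  have hηc : c * (η ^ 2 - η + 1) = k * η := by
    have : c * x = c + k := by rw [hx]; field_simp
    linear_combination c * hηx + η * this
  have hη0 : (η : ℂ) ≠ 0 := by
    rw [Complex.ofReal_ne_zero]; linarith
  have hnη : ‖((Units.mk0 (η : ℂ) hη0 : ℂˣ) : ℂ)‖ = η := by
    rw [Units.val_mk0, Complex.norm_real, Real.norm_of_nonneg (by linarith)]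
  have n₃ : ‖((θ₂⁻¹ : ℂˣ) : ℂ)‖ = 1 := by
    rw [Units.val_inv_eq_inv_val, norm_inv, n₂, inv_one]
  have hord : ∀ {θ : ℂˣ}, 7 ≤ orderOf θ → θ ^ 2 ≠ 1 := fun hθ e => by
    have := Nat.le_of_dvd two_pos (orderOf_dvd_of_pow_eq_one e)
    omega
  have hord' : ∀ {θ : ℂˣ}, 7 ≤ orderOf θ → θ ≠ 1 := fun hθ e => hord hθ (by rw [e, one_pow])
  have hθ₂ : 7 ≤ orderOf θ₂ := by omega
  refine ⟨θ₁, θ₂, θ₂⁻¹, Units.mk0 (η : ℂ) hη0, ⟨?_, ?_, ?_, ?_, ?_, ?_⟩, by omega⟩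
  · rw [o₁]; exact ⟨M + 3, by ring⟩
  · rw [o₂]; exact ⟨M + 4, by ring⟩
  · rw [orderOf_inv, o₂]; exact ⟨M + 4, by ring⟩
  · intro hfin
    obtain ⟨m, hm, hm1⟩ := isOfFinOrder_iff_pow_eq_one.mp hfin
    have := congrArg (fun u : ℂˣ => ‖(u : ℂ)‖) hm1
    simp only [Units.val_pow_eq_pow_val, norm_pow, hnη, Units.val_one, norm_one] at this
    exact (one_lt_pow₀ hη1 hm.ne').ne' this
  · refine isAdmissible_familyTwo n₁ n₂ n₃ (by rw [hnη]; exact hη1) (hord (by omega))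
      (hord' hθ₂) (inv_ne_one.mpr (hord' hθ₂)) fun e => hord hθ₂ ?_
    rw [sq]; exact eq_inv_iff_mul_eq_one.mp e
  · have e₁ : 1 + (θ₁ : ℂ) + (θ₁ : ℂ) ^ 2 = c * θ₁ := by
      have := mul_inv_cancel₀ θ₁.ne_zero
      rw [hc]; push_cast at c₁ ⊢
      linear_combination (θ₁ : ℂ) * c₁ - this
    have e₂ : 1 + (θ₂ : ℂ) + (θ₂ : ℂ)⁻¹ = k := by
      rw [hk]; push_cast at c₂ ⊢
      linear_combination c₂
    have e₃ : (c : ℂ) * ((η : ℂ) ^ 2 - η + 1) = k * η := by exact_mod_cast hηc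
    have e₄ := mul_inv_cancel₀ θ₂.ne_zero
    rw [Units.val_mk0, Units.val_inv_eq_inv_val]
    linear_combination ((η : ℂ) ^ 3 * θ₂ * (θ₂ : ℂ)⁻¹ + 1) * e₁ + ((η : ℂ) ^ 3 * c * θ₁
      - (η : ℂ) ^ 2 * θ₁) * e₄ - ((η : ℂ) ^ 2 + η) * θ₁ * e₂ + θ₁ * (η + 1) * e₃

/-! ### The explicit polynomial -/

section Example

variable {ζ : ℂˣ}

lemma exampleB_eq (hζ : IsPrimitiveRoot ζ 6) :
    exampleB ζ = familyOne 2 2 ζ (Units.mk0 (2 : ℂ) two_ne_zero * ζ ^ 2) := by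
  have h6 : ζ ^ 6 = 1 := hζ.pow_eq_one
  funext i
  fin_cases i
  · simp [exampleB, familyOne]
  · simp [exampleB, familyOne]
  · simp [exampleB, familyOne, h6]
  · change Units.mk0 (2 : ℂ) two_ne_zero * ζ ^ 4 = Units.mk0 (2 : ℂ) two_ne_zero * ζ ^ 2 * ζ ^ 8
    rw [mul_assoc, ← pow_add, show 2 + 8 = 6 + 4 by norm_num, pow_add, h6, one_mul]

lemma sq_of_isPrimitiveRoot_six (hζ : IsPrimitiveRoot ζ 6) : (ζ : ℂ) ^ 2 = ζ - 1 := by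
  have h : IsPrimitiveRoot (ζ : ℂ) 6 := IsPrimitiveRoot.coe_units_iff.mpr hζ
  have h6 := h.pow_eq_one
  have h3 : (ζ : ℂ) ^ 3 - 1 ≠ 0 :=
    sub_ne_zero.mpr (h.pow_ne_one_of_pos_of_lt (by norm_num) (by norm_num))
  have h2 : (ζ : ℂ) ^ 2 - 1 ≠ 0 :=
    sub_ne_zero.mpr (h.pow_ne_one_of_pos_of_lt (by norm_num) (by norm_num))
  have h1 : (ζ : ℂ) + 1 ≠ 0 := fun e => h2 (by linear_combination ((ζ : ℂ) - 1) * e)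
  have h0 : (ζ : ℂ) ^ 2 - ζ + 1 = 0 := by
    apply (mul_eq_zero.mp (?_ : ((ζ : ℂ) ^ 3 - 1) * (ζ + 1) * ((ζ : ℂ) ^ 2 - ζ + 1) = 0)
      ).resolve_left (mul_ne_zero h3 h1)
    linear_combination h6
  linear_combination h0

lemma polyD_exampleB (hζ : IsPrimitiveRoot ζ 6) : polyD (exampleB ζ) = exampleD := by
  have h2 := sq_of_isPrimitiveRoot_six hζ
  have h3 : (ζ : ℂ) ^ 4 = -ζ := by linear_combination ((ζ : ℂ) ^ 2 + ζ) * h2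
  have hi : (ζ : ℂ)⁻¹ = 1 - ζ := inv_eq_of_mul_eq_one_right (by linear_combination -h2)
  have r0 : rho (exampleB ζ) 0 = 1 / 2 := by
    rw [rho, Units.val_inv_eq_inv_val]
    change ((ζ : ℂ) + (ζ : ℂ)⁻¹) / 2 = _
    rw [hi]; ring
  have r1 : rho (exampleB ζ) 1 = -1 / 2 := by
    rw [rho, Units.val_inv_eq_inv_val]
    change ((ζ : ℂ) ^ 2 + ((ζ : ℂ) ^ 2)⁻¹) / 2 = _
    rw [← inv_pow, hi]; linear_combination h2
  have r2 : rho (exampleB ζ) 2 = 3 / 4 * ζ - 1 := by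
    rw [rho, Units.val_inv_eq_inv_val]
    change (2 * (ζ : ℂ) ^ 2 + (2 * (ζ : ℂ) ^ 2)⁻¹) / 2 = _
    rw [mul_inv, ← inv_pow, hi]; linear_combination (5 / 4 : ℂ) * h2
  have r3 : rho (exampleB ζ) 3 = -3 / 4 * ζ - 1 / 4 := by
    rw [rho, Units.val_inv_eq_inv_val]
    change (2 * (ζ : ℂ) ^ 4 + (2 * (ζ : ℂ) ^ 4)⁻¹) / 2 = _
    have hi4 : ((ζ : ℂ) ^ 4)⁻¹ = ζ - 1 := by
      rw [h3]
      exact inv_eq_of_mul_eq_one_right (by linear_combination -h2)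
    rw [mul_inv, hi4, h3]; ring
  refine Polynomial.funext fun x => ?_
  have hprod : (x - (3 / 4 * ζ - 1)) * (x - (-3 / 4 * ζ - 1 / 4)) = x ^ 2 + 5 / 4 * x + 13 / 16 := by
    linear_combination (-9 / 16 : ℂ) * h2
  have hD : (polyD (exampleB ζ)).eval x = (x ^ 2 - 1) * ((x - 1 / 2) * (x - -1 / 2)
      * ((x - (3 / 4 * ζ - 1)) * (x - (-3 / 4 * ζ - 1 / 4)))) ^ 2 := by
    simp only [polyD, Fin.prod_univ_four, r0, r1, r2, r3, eval_mul, eval_pow, eval_sub, eval_X,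
      eval_C, eval_one]
    ring
  rw [hD, hprod]
  simp only [exampleD, eval_mul, eval_pow, eval_sub, eval_add, eval_X, eval_C, eval_one,
    eval_ofNat]
  ring

lemma not_isOfFinOrder_two_mul (hζ : IsPrimitiveRoot ζ 6) :
    ¬ IsOfFinOrder (Units.mk0 (2 : ℂ) two_ne_zero * ζ ^ 2) := by
  intro h
  have hζf : IsOfFinOrder ζ := isOfFinOrder_iff_pow_eq_one.mpr ⟨6, by norm_num, hζ.pow_eq_one⟩
  have h2 := h.mul (hζf.pow (n := 2)).inv
  rw [mul_inv_cancel_right] at h2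
  obtain ⟨m, hm, hm1⟩ := isOfFinOrder_iff_pow_eq_one.mp h2
  have := congrArg (fun u : ℂˣ => ‖(u : ℂ)‖) hm1
  simp only [Units.val_pow_eq_pow_val, norm_pow, Units.val_mk0, Units.val_one, norm_one,
    Complex.norm_ofNat] at this
  exact (one_lt_pow₀ one_lt_two hm.ne').ne' this

lemma nsmul_delta_exampleB_mem (hζ : IsPrimitiveRoot ζ 6) (n : ℕ) :
    (3 * n) • delta (exampleB ζ) ∈ setW (exampleB ζ) 3 := by
  have hh := not_isOfFinOrder_two_mul hζ
  rw [exampleB_eq hζ]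
  have hb := isAdmissible_familyOne (p := 2) (q := 2) (l := 3) le_rfl (by norm_num) hζ hh
  match n with
  | 0 =>
    refine nsmul_delta_mem_setW hb (by norm_num) (A := 1) (by simp) (by simp) (by simp)
  | 1 =>
    -- Membership for n = 0 and n = 1 is elementary, the points being three times ∞₊, respectively
    -- ∞₋. The binomial witnesses start with the multiple 6δ.
    refine nsmul_delta_mem_setW hb (by norm_num) (A := X ^ 3) (by simp)
      (fun i => by simp) (fun i => ?_)
    have := (familyOne 2 2 ζ (Units.mk0 (2 : ℂ) two_ne_zero * ζ ^ 2) i).ne_zero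
    simp only [eval_pow, eval_X]
    field_simp
  | k + 2 =>
    obtain ⟨A, hA⟩ := exists_isWitness_familyOne (p := 2) (q := 2) (l := 3) (by norm_num) hζ hh
      (k + 1) k.succ_pos
    rw [show 3 * (k + 2) = (k + 1 + 1) * 3 by ring]
    exact hA.nsmul_delta_mem hb (by norm_num)

/-- With g = 4, l = 3 and n = 3(k + 2), the witnesses give consecutive denominator degrees 3k + 1
and 3k + 3. Strict monotonicity leaves no room between 3k and 3k + 1, so the degrees are exactly 0,
1, 3, 4, 6, 7, …. -/
lemma denDeg_example (hζ : IsPrimitiveRoot ζ 6) {f : LaurentSeries ℂ}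
    (hf : f ^ 2 = seriesOf (polyD (exampleB ζ))) (k : ℕ) :
    denDeg f (2 * k) = 3 * k ∧ denDeg f (2 * k + 1) = 3 * k + 1 := by
  have hh := not_isOfFinOrder_two_mul hζ
  rw [exampleB_eq hζ] at hf
  have hb := isAdmissible_familyOne (p := 2) (q := 2) (l := 3) le_rfl (by norm_num) hζ hh
  have hmono := denDeg_strictMono (isIrrational_of_sq_eq_polyD hf)
  have key : ∀ k, ∃ i, denDeg f i = 3 * k + 1 ∧ denDeg f (i + 1) = 3 * k + 3 := fun k => by
    obtain ⟨A, hA⟩ := exists_isWitness_familyOne (p := 2) (q := 2) (l := 3) (by norm_num) hζ hh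
      (k + 1) k.succ_pos
    obtain ⟨i, h1, h2⟩ := hA.exists_denDeg hb (by norm_num) (by omega) hf
    exact ⟨i, by omega, by omega⟩
  have step : ∀ k, denDeg f (2 * k) = 3 * k →
      denDeg f (2 * k + 1) = 3 * k + 1 ∧ denDeg f (2 * k + 2) = 3 * k + 3 := fun k h => by
    obtain ⟨i, h1, h2⟩ := key k
    have hlt : 2 * k < i := hmono.lt_iff_lt.mp (by omega)
    have hle : denDeg f (2 * k + 1) ≤ denDeg f i := hmono.monotone hlt
    have hlt' : denDeg f (2 * k) < denDeg f (2 * k + 1) := hmono (Nat.lt_succ_self _)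
    have heq : denDeg f (2 * k + 1) = denDeg f i := by omega
    have hi := hmono.injective heq
    rw [← hi] at h1 h2
    exact ⟨h1, h2⟩
  have even : denDeg f (2 * k) = 3 * k := by
    induction k with
    | zero => rfl
    | succ k ih => rw [show 2 * (k + 1) = 2 * k + 2 by ring, (step k ih).2]; ring
  exact ⟨even, (step k even).1⟩

lemma natDegree_partialQuotient_zero {g : ℕ} {b : Fin g → ℂˣ} {f : LaurentSeries ℂ}
    (hf : f ^ 2 = seriesOf (polyD b)) : (partialQuotient f 0).natDegree = g + 1 := by
  have ho := order_of_sq_eq_polyD hf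
  have := natDegree_polyPart (f := f) (by omega)
  change (polyPart f).natDegree = _
  omega

end Example

end PolyPell

end

/-! ### Assembly of the three claims. -/

theorem mainTheorem3 :
    -- the first family
    (∀ (l p q : ℕ) (ω h : ℂˣ), 1 ≤ p → 1 ≤ q → p + 1 ≤ l → q ≤ l → l ≤ p + q → p + q + 1 ≤ 2 * l →
      IsPrimitiveRoot ω (2 * l) → ¬ IsOfFinOrder h →
      PolyPell.IsAdmissible (PolyPell.familyOne p q ω h) ∧
      ¬ PolyPell.IsPellian (PolyPell.polyD (PolyPell.familyOne p q ω h)) ∧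
      {n : ℕ | n • PolyPell.delta (PolyPell.familyOne p q ω h) ∈
        PolyPell.setW (PolyPell.familyOne p q ω h) l}.Infinite ∧
      (∃ s : LaurentSeries ℂ,
        s ^ 2 = PolyPell.seriesOf (PolyPell.polyD (PolyPell.familyOne p q ω h))) ∧
      ∀ s : LaurentSeries ℂ,
        s ^ 2 = PolyPell.seriesOf (PolyPell.polyD (PolyPell.familyOne p q ω h)) →
        ¬ PolyPell.IsEventuallyPeriodic (PolyPell.partialQuotient s) ∧
        {n : ℕ | p + q + 1 ≤ l + (PolyPell.partialQuotient s n).natDegree}.Infinite ∧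
        (l < p + q → {n : ℕ | 1 < (PolyPell.partialQuotient s n).natDegree}.Infinite)) ∧
    -- the second family
    (∀ θ₁ θ₂ θ₃ h : ℂˣ, PolyPell.IsFamilyTwoParam θ₁ θ₂ θ₃ h →
      ¬ PolyPell.IsPellian (PolyPell.polyD (PolyPell.familyTwo θ₁ θ₂ θ₃ h)) ∧
      {n : ℕ | (orderOf θ₁ : ℤ) ∣ 2 * (n : ℤ) - 3 ∧ (orderOf θ₂ : ℤ) ∣ 2 * (n : ℤ) - 3 ∧
        (orderOf θ₃ : ℤ) ∣ 2 * (n : ℤ) - 3 ∧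
        n • PolyPell.delta (PolyPell.familyTwo θ₁ θ₂ θ₃ h) ∈
          PolyPell.setW (PolyPell.familyTwo θ₁ θ₂ θ₃ h) 3}.Infinite ∧
      (∃ s : LaurentSeries ℂ,
        s ^ 2 = PolyPell.seriesOf (PolyPell.polyD (PolyPell.familyTwo θ₁ θ₂ θ₃ h))) ∧
      ∀ s : LaurentSeries ℂ,
        s ^ 2 = PolyPell.seriesOf (PolyPell.polyD (PolyPell.familyTwo θ₁ θ₂ θ₃ h)) →
        ¬ PolyPell.IsEventuallyPeriodic (PolyPell.partialQuotient s) ∧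
        {n : ℕ | (PolyPell.partialQuotient s n).natDegree = 2}.Infinite) ∧
    (∀ M : ℕ, ∃ θ₁ θ₂ θ₃ h : ℂˣ, PolyPell.IsFamilyTwoParam θ₁ θ₂ θ₃ h ∧ M ≤ orderOf θ₁) ∧
    -- the explicit polynomial of degree 10
    (∀ ζ : ℂˣ, IsPrimitiveRoot ζ 6 →
      PolyPell.IsAdmissible (PolyPell.exampleB ζ) ∧
      PolyPell.polyD (PolyPell.exampleB ζ) = PolyPell.exampleD ∧
      ∀ n : ℕ, (3 * n) • PolyPell.delta (PolyPell.exampleB ζ) ∈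
        PolyPell.setW (PolyPell.exampleB ζ) 3) ∧
    ¬ PolyPell.IsPellian PolyPell.exampleD ∧
    (∃ s : LaurentSeries ℂ, s ^ 2 = PolyPell.seriesOf PolyPell.exampleD) ∧
    ∀ s : LaurentSeries ℂ, s ^ 2 = PolyPell.seriesOf PolyPell.exampleD →
      ¬ PolyPell.IsEventuallyPeriodic (PolyPell.partialQuotient s) ∧
      (PolyPell.partialQuotient s 0).natDegree = 5 ∧
      ∀ k : ℕ, (PolyPell.partialQuotient s (2 * k + 1)).natDegree = 1 ∧
        (PolyPell.partialQuotient s (2 * k + 2)).natDegree = 2 := by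
  refine ⟨?_, ?_, PolyPell.exists_isFamilyTwoParam, ?_, ?_⟩
  · intro l p q ω h hp hq hpl hql hlg _ hω hh
    have hl : 0 < l := by omega
    have hb := PolyPell.isAdmissible_familyOne hpl hql hω hh
    obtain ⟨i, hi⟩ := PolyPell.exists_not_isOfFinOrder_familyOne (p := p) hq hω hl hh
    have hwit := PolyPell.exists_large_isWitness_familyOne (p := p) (q := q) hl hω hh
    refine ⟨hb, PolyPell.not_isPellian_of_not_isOfFinOrder hi, ?_, PolyPell.exists_sqrt_polyD _,
      fun s hs => ?_⟩
    · refine Set.infinite_of_forall_exists_gt fun B => ?_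
      obtain ⟨n, hn, A, hA⟩ := hwit (B + 1)
      exact ⟨n, hA.nsmul_delta_mem hb (by omega), hn⟩
    · have hinf := PolyPell.infinite_natDegree_partialQuotient hb hlg hwit hs
      refine ⟨PolyPell.not_isEventuallyPeriodic hi hs, hinf.mono fun n hn => ?_,
        fun hlt => hinf.mono fun n hn => ?_⟩
      · rw [Set.mem_ofPred_eq] at hn ⊢; omega
      · rw [Set.mem_ofPred_eq] at hn ⊢; omega
  · intro θ₁ θ₂ θ₃ h hP
    have hb := hP.admissible
    have hi : ¬ IsOfFinOrder (PolyPell.familyTwo θ₁ θ₂ θ₃ h 1) := hP.not_root_of_unity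
    have hwit := PolyPell.exists_large_isWitness_familyTwo hP
    refine ⟨PolyPell.not_isPellian_of_not_isOfFinOrder hi, ?_, PolyPell.exists_sqrt_polyD _,
      fun s hs => ⟨PolyPell.not_isEventuallyPeriodic hi hs, ?_⟩⟩
    · refine Set.infinite_of_forall_exists_gt fun B => ?_
      obtain ⟨n, hn, ⟨h1, h2, h3⟩, A, hA⟩ := hwit (B + 1)
      exact ⟨n, ⟨h1, h2, h3, hA.nsmul_delta_mem hb (by norm_num)⟩, hn⟩
    · refine (PolyPell.infinite_natDegree_partialQuotient (l := 3) hb (by norm_num)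
        (fun B => ?_) hs).mono fun n hn => ?_
      · obtain ⟨n, hn, -, hA⟩ := hwit B
        exact ⟨n, hn, hA⟩
      · rw [Set.mem_ofPred_eq] at hn ⊢; omega
  · intro ζ hζ
    refine ⟨?_, PolyPell.polyD_exampleB hζ, PolyPell.nsmul_delta_exampleB_mem hζ⟩
    rw [PolyPell.exampleB_eq hζ]
    exact PolyPell.isAdmissible_familyOne (l := 3) le_rfl (by norm_num) hζ
      (PolyPell.not_isOfFinOrder_two_mul hζ)
  · obtain ⟨ζ, hζ⟩ : ∃ ζ : ℂˣ, IsPrimitiveRoot ζ 6 :=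
      ⟨Units.mk0 _ (Complex.exp_ne_zero _), IsPrimitiveRoot.coe_units_iff.mp
        (Complex.isPrimitiveRoot_exp 6 (by norm_num))⟩
    obtain ⟨i, hi⟩ : ∃ i, ¬ IsOfFinOrder (PolyPell.exampleB ζ i) := by
      rw [PolyPell.exampleB_eq hζ]
      exact PolyPell.exists_not_isOfFinOrder_familyOne (l := 3) (q := 2) (by norm_num) hζ (by norm_num)
        (PolyPell.not_isOfFinOrder_two_mul hζ)
    rw [← PolyPell.polyD_exampleB hζ]
    refine ⟨PolyPell.not_isPellian_of_not_isOfFinOrder hi, PolyPell.exists_sqrt_polyD _,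
      fun s hs => ⟨PolyPell.not_isEventuallyPeriodic hi hs,
        PolyPell.natDegree_partialQuotient_zero hs, fun k => ?_⟩⟩
    obtain ⟨h0, h1⟩ := PolyPell.denDeg_example hζ hs k
    obtain ⟨h2, -⟩ := PolyPell.denDeg_example hζ hs (k + 1)
    have e1 := PolyPell.denDeg_succ s (2 * k)
    have e2 := PolyPell.denDeg_succ s (2 * k + 1)
    rw [show 2 * (k + 1) = 2 * k + 1 + 1 by ring] at h2
    rw [show 2 * k + 2 = 2 * k + 1 + 1 by ring]
    omega
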